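/- For $\sigma>0$ let $\varphi_G(t,\sigma)=\exp\left(-\frac{t^2}{2\sigma^2}\right)$ and $\varphi_L(t,\sigma)=\frac{\sigma^2}{\sigma^2+t^2}$, $t\in\mathbb R$. A nod function of $\varphi$ is a function of the form $\widetilde\varphi(t)=\sum_{k\in\mathbb Z}d_k\varphi(t-k)$, $t\in\mathbb R$, with $(d_k)\in\ell_2(\mathbb Z)$, such that $\widetilde\varphi(m)=\delta_{0m}$ for all $m\in\mathbb Z$. Functions $f_k\in L_2(\mathbb R)$, $k\in\mathbb Z$, form a Riesz system if there are constants $A,B>0$ such that for every $c\in\ell_2(\mathbb Z)$ the series $\sum_k c_kf_k$ converges in $L_2(\mathbb R)$ and $A\|c\|^2\le\left\|\sum_k c_kf_k\right\|^2\le B\|c\|^2$; the largest such $A$ is the lower and the smallest such $B$ the upper Riesz constant. Theorem. For every $\sigma>0$ the functions $\varphi_G(\cdot,\sigma)$ and $\varphi_L(\cdot,\sigma)$ have unique nod functions $\widetilde\varphi_G(\cdot,\sigma)$ and $\widetilde\varphi_L(\cdot,\sigma)$, and the integer shifts of each nod function form a Riesz system. Let $\widetilde A_G(\sigma),\widetilde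 B_G(\sigma)$ and $\widetilde A_L(\sigma),\widetilde B_L(\sigma)$ be the lower and upper Riesz constants of the systems $\{\widetilde\varphi_G(t-k,\sigma)\}_{k\in\mathbb Z}$ and $\{\widetilde\varphi_L(t-k,\sigma)\}_{k\in\mathbb Z}$. Then $$\lim_{\sigma\to\infty}\widetilde A_G(\sigma)=\lim_{\sigma\to\infty}\widetilde A_L(\sigma)=\frac12,\qquad \lim_{\sigma\to\infty}\widetilde B_G(\sigma)=\lim_{\sigma\to\infty}\widetilde B_L(\sigma)=1 .$$ Moreover, for every $\sigma>0$, $$\widetilde A_L(\sigma)=\frac{\sinh^2(\sigma\pi)}{\sinh(2\sigma\pi)},\qquad \widetilde B_L(\sigma)=\frac{\sinh^2(\sigma\pi)}{\sinh(2\sigma\pi)}\left(2-\frac1{\cosh^2(\sigma\pi)}\right).$$ In the Gauss case, for every $\sigma>0$, $\widetilde\varphi_G(\cdot,\sigma)$ is integrable and, with $\hat f(\omega)=\frac1{\sqrt{2\pi}}\int_{\mathbb R}f(t)e^{-i\omega t}\,dt$, the series $$\widetilde P_G(\omega,\sigma)=2\pi\sum_{k\in\mathbb Z}\left|\hat{\widetilde\varphi}_G(\omega+2\pi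 k,\sigma)\right|^2$$ converges for every $\omega\in\mathbb R$, its minimum over $\omega$ is attained at $\omega=\pi$, and $\widetilde A_G(\sigma)=\widetilde P_G(\pi,\sigma)$. -/

import Mathlib

open MeasureTheory Filter Topology

noncomputable section

/-- `A` and `B` are admissible in the two-sided Riesz estimate for the functions `f k`, `k ∈ ℤ`:
every `f k` lies in `L²(ℝ)` and, for every `c ∈ ℓ²(ℤ)`, the series `∑ c k • f k` converges in
`L²(ℝ)` and the square of the norm of its sum lies between `A ‖c‖²` and `B ‖c‖²`. -/
def HasRieszBounds (f : ℤ → ℝ → ℂ) (A B : ℝ) : Prop :=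
  ∃ hf : ∀ k, MemLp (f k) 2 (volume : Measure ℝ),
    ∀ c : lp (fun _ : ℤ => ℂ) 2, ∃ s : Lp ℂ 2 (volume : Measure ℝ),
      HasSum (fun k : ℤ => c k • (hf k).toLp (f k)) s ∧
        A * ‖c‖ ^ 2 ≤ ‖s‖ ^ 2 ∧ ‖s‖ ^ 2 ≤ B * ‖c‖ ^ 2

/-- The functions `f k`, `k ∈ ℤ`, form a Riesz system. -/
def IsRieszSystem (f : ℤ → ℝ → ℂ) : Prop :=
  ∃ A B : ℝ, 0 < A ∧ 0 < B ∧ HasRieszBounds f A B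

/-- The lower Riesz constant: the largest admissible `A`
(the supremum is a maximum, see `IsRieszSystem.isGreatest`). -/
def lowerRieszConstant (f : ℤ → ℝ → ℂ) : ℝ :=
  sSup {A : ℝ | 0 < A ∧ ∃ B : ℝ, 0 < B ∧ HasRieszBounds f A B}

/-- The upper Riesz constant: the smallest admissible `B`
(the infimum is a minimum, see `IsRieszSystem.isLeast`). -/
def upperRieszConstant (f : ℤ → ℝ → ℂ) : ℝ :=
  sInf {B : ℝ | 0 < B ∧ ∃ A : ℝ, 0 < A ∧ HasRieszBounds f A B}

/-- Any lower bound and any upper bound can be combined. -/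
theorem HasRieszBounds.combine {f : ℤ → ℝ → ℂ} {A B A' B' : ℝ}
    (h : HasRieszBounds f A B) (h' : HasRieszBounds f A' B') : HasRieszBounds f A B' := by
  obtain ⟨hf, h⟩ := h
  obtain ⟨_, h'⟩ := h'
  refine ⟨hf, fun c => ?_⟩
  obtain ⟨s, hs, h1, _⟩ := h c
  obtain ⟨s', hs', _, h2⟩ := h' c
  obtain rfl := hs.unique hs'
  exact ⟨s, hs, h1, h2⟩

/-- An admissible lower bound does not exceed an admissible upper bound. -/
theorem HasRieszBounds.le {f : ℤ → ℝ → ℂ} {A B A' B' : ℝ}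
    (h : HasRieszBounds f A B) (h' : HasRieszBounds f A' B') : A ≤ B' := by
  obtain ⟨_, h⟩ := h.combine h'
  obtain ⟨s, _, h1, h2⟩ := h (lp.single 2 (0 : ℤ) (1 : ℂ))
  have hn : ‖(lp.single 2 (0 : ℤ) (1 : ℂ) : lp (fun _ : ℤ => ℂ) 2)‖ = 1 := by
    rw [lp.norm_single (by norm_num)]
    simp
  rw [hn] at h1 h2
  linarith

theorem IsRieszSystem.isGreatest {f : ℤ → ℝ → ℂ} (h : IsRieszSystem f) :
    IsGreatest {A : ℝ | 0 < A ∧ ∃ B : ℝ, 0 < B ∧ HasRieszBounds f A B}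
      (lowerRieszConstant f) := by
  obtain ⟨A₀, B₀, hA₀, hB₀, h₀⟩ := h
  have hne : {A : ℝ | 0 < A ∧ ∃ B : ℝ, 0 < B ∧ HasRieszBounds f A B}.Nonempty :=
    ⟨A₀, hA₀, B₀, hB₀, h₀⟩
  have hbd : BddAbove {A : ℝ | 0 < A ∧ ∃ B : ℝ, 0 < B ∧ HasRieszBounds f A B} :=
    ⟨B₀, fun A hA => by obtain ⟨_, B, _, hB⟩ := hA; exact hB.le h₀⟩
  refine ⟨⟨lt_of_lt_of_le hA₀ (le_csSup hbd ⟨hA₀, B₀, hB₀, h₀⟩), B₀, hB₀, ?_⟩,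
    fun A hA => le_csSup hbd hA⟩
  obtain ⟨hf, h₁⟩ := id h₀
  refine ⟨hf, fun c => ?_⟩
  obtain ⟨s, hs, _, hs2⟩ := h₁ c
  refine ⟨s, hs, ?_, hs2⟩
  rcases (sq_nonneg ‖c‖).eq_or_lt with h0 | h0
  · rw [← h0, mul_zero]; positivity
  · rw [← le_div_iff₀ h0]
    refine csSup_le hne fun A hA => ?_
    obtain ⟨_, B, _, _, hB⟩ := hA
    obtain ⟨s', hs', h1, _⟩ := hB c
    obtain rfl := hs.unique hs'
    rwa [le_div_iff₀ h0]

theorem IsRieszSystem.isLeast {f : ℤ → ℝ → ℂ} (h : IsRieszSystem f) :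
    IsLeast {B : ℝ | 0 < B ∧ ∃ A : ℝ, 0 < A ∧ HasRieszBounds f A B}
      (upperRieszConstant f) := by
  obtain ⟨A₀, B₀, hA₀, hB₀, h₀⟩ := h
  have hne : {B : ℝ | 0 < B ∧ ∃ A : ℝ, 0 < A ∧ HasRieszBounds f A B}.Nonempty :=
    ⟨B₀, hB₀, A₀, hA₀, h₀⟩
  have hbd : BddBelow {B : ℝ | 0 < B ∧ ∃ A : ℝ, 0 < A ∧ HasRieszBounds f A B} :=
    ⟨A₀, fun B hB => by obtain ⟨_, A, _, hA⟩ := hB; exact h₀.le hA⟩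
  refine ⟨⟨lt_of_lt_of_le hA₀ (le_csInf hne fun B hB => ?_), A₀, hA₀, ?_⟩,
    fun B hB => csInf_le hbd hB⟩
  · obtain ⟨_, A, _, hA⟩ := hB
    exact h₀.le hA
  obtain ⟨hf, h₁⟩ := id h₀
  refine ⟨hf, fun c => ?_⟩
  obtain ⟨s, hs, hs1, hs2⟩ := h₁ c
  refine ⟨s, hs, hs1, ?_⟩
  rcases (sq_nonneg ‖c‖).eq_or_lt with h0 | h0
  · rw [← h0, mul_zero] at hs2 ⊢; exact hs2
  · rw [← div_le_iff₀ h0]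
    refine le_csInf hne fun B hB => ?_
    obtain ⟨_, A, _, _, hA⟩ := hB
    obtain ⟨s', hs', _, h1⟩ := hA c
    obtain rfl := hs.unique hs'
    rwa [div_le_iff₀ h0]

/-- The system of integer shifts `t ↦ φ (t - k)`, `k ∈ ℤ`. -/
def shifts (φ : ℝ → ℂ) (k : ℤ) (t : ℝ) : ℂ := φ (t - k)

/-- `ψ` is a nod function of `φ`: `ψ(t) = ∑ d k * φ(t - k)` for all `t`, with a coefficient
sequence `d ∈ ℓ²(ℤ)`, and `ψ(m) = δ_{0m}` for all integers `m`. -/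
def IsNodFunction (φ ψ : ℝ → ℂ) : Prop :=
  (∃ d : ℤ → ℂ, Memℓp d 2 ∧ ∀ t : ℝ, HasSum (fun k : ℤ => d k * φ (t - k)) (ψ t)) ∧
    ∀ m : ℤ, ψ m = if m = 0 then 1 else 0

/-- The Gauss function `exp (-t² / (2σ²))`. -/
def gaussFun (σ t : ℝ) : ℂ := (Real.exp (-(t ^ 2 / (2 * σ ^ 2))) : ℝ)

/-- The Cauchy–Lorentz function `σ² / (σ² + t²)`. -/
def lorentzFun (σ t : ℝ) : ℂ := (σ ^ 2 / (σ ^ 2 + t ^ 2) : ℝ)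

/-- The Fourier transform `(2π)^(-1/2) ∫ ψ(t) e^{-iωt} dt` (for integrable `ψ`). -/
def unitaryFourier (ψ : ℝ → ℂ) (ω : ℝ) : ℂ :=
  (1 / Real.sqrt (2 * Real.pi) : ℝ) * ∫ t : ℝ, ψ t * Complex.exp (-(Complex.I * ω * t))

/-- The periodization `P(ω) = 2π ∑ |ψ̂(ω + 2πk)|²`. -/
def periodization (ψ : ℝ → ℂ) (ω : ℝ) : ℝ :=
  2 * Real.pi * ∑' k : ℤ, ‖unitaryFourier ψ (ω + 2 * Real.pi * k)‖ ^ 2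

end

/-!
Both generators `φ` are Fourier transforms of a positive, even, exponentially decaying density `h`
(`IsSpectralDensity`): a Gaussian for the Gauss function, and `π σ exp (-2 π σ |x|)` for the Lorentz
function. Write `H = ∑ h (· + n)` for the periodization of `h`. The reciprocal `1 / H` is
differentiable on a period, up to its end points, and therefore has an absolutely convergent Fourier
series `∑ d k e^{2πikx}`. Transforming `h / H` term by term gives `∑ d k φ(t - k)`, and since the
translates of `h / H` sum to `1`, the values of this function at the integers are the Fourier
coefficients of the constant `1`. So the transform of `h / H` is a nod function, and it is the only
one, because `d` is an absolutely summable convolution inverse of `(φ m)`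
(`IsSpectralDensity.existsUnique_isNodFunction`).

By Plancherel's identity and unfolding, `‖∑ c k ψ(· - k)‖²` is the integral over a period of
`|∑ c k e^{2πikx}|²` against the symbol `P = ∑ h (· + n)² / H²`
(`IsSpectralDensity.norm_sq_sum_shifts`). As trigonometric polynomials are dense in the continuous
functions on the circle, the Riesz bounds are exactly the bounds of `P` (`hasRieszBounds_iff`), so
that the Riesz constants are the minimum and the maximum of `P`. Moreover `P(x)` is
`periodization ψ (2πx)`, by Fourier inversion.

In the Lorentz case `P` is computed from two geometric series. In the Gauss case
`P(x) = a_{2s}(x) / a_s(x)²` with `a_s(x) = ∑ exp (-s (x + n)²)`. Rotating the lattice `ℤ²` by 45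
degrees (`thetaSum_mul`) gives
`1 / P(x) = a_{2s}(0) + a_{2s}(1/2) a_{2s}(x + 1/2) / a_{2s}(x)`, and the same rotation shows that
`a_t(0) a_t(x) - a_t(x + 1/2) a_t(1/2)` is a square. Hence `P` is smallest at `x = 1/2`, where it
equals `1 / (2 a_{2s}(0))`, which tends to `1/2`. The maximum of `P` lies between `P(0)`, which
tends to `1`, and `1`.
-/

open scoped FourierTransform

/-! ### Periodization of exponentially decaying functions -/

/-- The function `h` decays exponentially at infinity. -/
def HasExpDecay (h : ℝ → ℝ) : Prop := ∃ K c : ℝ, 0 < c ∧ ∀ x, |h x| ≤ K * Real.exp (-(c * |x|))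

/-- The 1-periodic function `x ↦ ∑ h (x + n)`, `n ∈ ℤ`. -/
noncomputable def periodize (h : ℝ → ℝ) (x : ℝ) : ℝ := ∑' n : ℤ, h (x + n)

theorem summable_exp_neg_mul_abs_int {c : ℝ} (hc : 0 < c) :
    Summable fun n : ℤ => Real.exp (-(c * |(n : ℝ)|)) := by
  have h : Summable fun n : ℕ => Real.exp (-(c * n)) := by
    have := Real.summable_exp_nat_mul_iff.2 (neg_lt_zero.2 hc)
    refine this.congr fun n => by ring_nf
  refine Summable.of_nat_of_neg (h.congr fun n => ?_) (h.congr fun n => ?_) <;> simp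

theorem integrable_exp_neg_mul_abs {c : ℝ} (hc : 0 < c) :
    Integrable fun x : ℝ => Real.exp (-(c * |x|)) := by
  rw [← integrableOn_univ, ← Set.Iic_union_Ioi (a := (0 : ℝ))]
  refine IntegrableOn.union ?_ ?_
  · refine (integrableOn_exp_mul_Iic hc 0).congr_fun (fun x hx => ?_) measurableSet_Iic
    simp only [Set.mem_Iic] at hx
    rw [abs_of_nonpos hx]; ring_nf
  · refine (integrableOn_exp_mul_Ioi (neg_lt_zero.2 hc) 0).congr_fun (fun x hx => ?_)
      measurableSet_Ioi
    simp only [Set.mem_Ioi] at hx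
    rw [abs_of_pos hx]; ring_nf

namespace HasExpDecay

variable {h h' g : ℝ → ℝ}

theorem integrable (hh : HasExpDecay h) (hc : Continuous h) : Integrable h := by
  obtain ⟨K, c, c0, hK⟩ := hh
  exact ((integrable_exp_neg_mul_abs c0).const_mul K).mono' hc.aestronglyMeasurable
    (ae_of_all _ hK)

theorem exists_summable_bound (hh : HasExpDecay h) (R : ℝ) :
    ∃ u : ℤ → ℝ, Summable u ∧ ∀ (n : ℤ) (x : ℝ), |x| ≤ R → ‖h (x + n)‖ ≤ u n := by
  obtain ⟨K, c, c0, hK⟩ := hh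
  have hK0 : 0 ≤ K := by
    have := (abs_nonneg _).trans (hK 0)
    simpa using this
  refine ⟨fun n => K * Real.exp (c * R) * Real.exp (-(c * |(n : ℝ)|)),
    (summable_exp_neg_mul_abs_int c0).mul_left _, fun n x hx => (hK _).trans ?_⟩
  simp only [mul_assoc, ← Real.exp_add]
  gcongr
  have : |(n : ℝ)| ≤ |x + n| + |x| := by
    have := abs_sub (x + n) x
    simpa using this
  nlinarith

theorem summable (hh : HasExpDecay h) (x : ℝ) : Summable fun n : ℤ => h (x + n) := by
  obtain ⟨u, hu, hb⟩ := hh.exists_summable_bound |x|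
  exact .of_norm_bounded hu fun n => hb n x le_rfl

theorem continuous_periodize (hh : HasExpDecay h) (hc : Continuous h) :
    Continuous (periodize h) := by
  rw [continuous_iff_continuousAt]
  intro x
  obtain ⟨u, hu, hb⟩ := hh.exists_summable_bound (|x| + 1)
  have : ContinuousOn (periodize h) (Metric.ball x 1) :=
    continuousOn_tsum (fun n => by fun_prop) hu fun n y hy => hb n y (by
      have := abs_sub_abs_le_abs_sub y x
      rw [Metric.mem_ball, Real.dist_eq] at hy
      linarith)
  exact this.continuousAt (Metric.ball_mem_nhds x one_pos)

theorem hasDerivAt_periodize (hh : HasExpDecay h) (hh' : HasExpDecay h')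
    (hd : ∀ x, HasDerivAt h (h' x) x) (x : ℝ) :
    HasDerivAt (periodize h) (periodize h' x) x := by
  obtain ⟨u, hu, hb⟩ := hh'.exists_summable_bound (|x| + 1)
  refine hasDerivAt_tsum_of_isPreconnected (t := Metric.ball x 1) (g := fun (n : ℤ) x => h (x + n))
    (g' := fun (n : ℤ) x => h' (x + n)) hu Metric.isOpen_ball
    (convex_ball x 1).isPreconnected (fun n y _ => ?_) (fun n y hy => hb n y ?_)
    (Metric.mem_ball_self one_pos) (hh.summable x) (Metric.mem_ball_self one_pos)
  · exact (hd (y + n)).comp_add_const y n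
  · have := abs_sub_abs_le_abs_sub y x
    rw [Metric.mem_ball, Real.dist_eq] at hy
    linarith

theorem periodize_pos (hh : HasExpDecay h) (hpos : ∀ x, 0 < h x) (x : ℝ) : 0 < periodize h x :=
  (hh.summable x).tsum_pos (fun _ => (hpos _).le) 0 (hpos _)

theorem sq (hh : HasExpDecay h) : HasExpDecay fun x => h x ^ 2 := by
  obtain ⟨K, c, c0, hK⟩ := hh
  refine ⟨K ^ 2, 2 * c, by positivity, fun x => ?_⟩
  have h1 : Real.exp (-(2 * c * |x|)) = Real.exp (-(c * |x|)) ^ 2 := by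
    rw [← Real.exp_nat_mul]; push_cast; ring_nf
  rw [h1, ← mul_pow, abs_pow]
  gcongr
  exact hK x

theorem const_mul (hh : HasExpDecay h) (a : ℝ) :
    HasExpDecay fun x => a * h x := by
  obtain ⟨K, c, c0, hK⟩ := hh
  refine ⟨|a| * K, c, c0, fun x => ?_⟩
  rw [abs_mul, mul_assoc]
  gcongr
  exact hK x

end HasExpDecay

theorem periodize_add_int (h : ℝ → ℝ) (x : ℝ) (m : ℤ) : periodize h (x + m) = periodize h x := by
  rw [periodize, periodize, ← (Equiv.addLeft m).tsum_eq fun n : ℤ => h (x + n)]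
  simp [add_assoc]

theorem periodize_add_one (h : ℝ → ℝ) (x : ℝ) : periodize h (x + 1) = periodize h x := by
  simpa using periodize_add_int h x 1

theorem periodize_neg {h : ℝ → ℝ} (he : ∀ x, h (-x) = h x) (x : ℝ) :
    periodize h (-x) = periodize h x := by
  rw [periodize, periodize, ← (Equiv.neg ℤ).tsum_eq]
  congr with n
  rw [← he]
  simp [add_comm]

theorem periodize_const_mul (h : ℝ → ℝ) (K x : ℝ) :
    periodize (fun y => K * h y) x = K * periodize h x := tsum_mul_left

/-- Unfolding: the integral over the line is the integral of the periodization over a period. -/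
theorem integral_eq_intervalIntegral_tsum {g : ℝ → ℂ} (hg : Integrable g) :
    ∫ x, g x = ∫ x in (0 : ℝ)..1, ∑' n : ℤ, g (x + n) := by
  rw [intervalIntegral.integral_of_le zero_le_one]
  refine hg.hasSum_intervalIntegral_comp_add_int.unique ?_
  simp_rw [intervalIntegral.integral_of_le (zero_le_one' ℝ)]
  refine hasSum_integral_of_summable_integral_norm
    (fun n => (hg.comp_add_right (n : ℝ)).integrableOn) ?_
  have := hg.norm.hasSum_intervalIntegral_comp_add_int.summable
  simpa only [intervalIntegral.integral_of_le (zero_le_one' ℝ)] using this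

/-! ### Absolutely convergent Fourier series -/

theorem continuous_liftIco_unit {f : ℝ → ℂ} (hf : Continuous f) (h01 : f 0 = f 1) :
    Continuous (AddCircle.liftIco (1 : ℝ) 0 f) :=
  AddCircle.liftIco_zero_continuous h01 hf.continuousOn

/-- Integrating by parts bounds the `n`-th coefficient of `f` by `1 / n²` plus the square of the
`n`-th coefficient of `f'`, which is summable by Parseval's identity. -/
theorem summable_fourierCoeff_liftIco {f f' : ℝ → ℂ} (hf : ∀ x, HasDerivAt f (f' x) x)
    (hf' : Continuous f') (h01 : f 0 = f 1) :
    Summable (fourierCoeff (AddCircle.liftIco (1 : ℝ) 0 f)) := by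
  have e1 : ∀ (f : ℝ → ℂ) (n : ℤ), fourierCoeff (AddCircle.liftIco (1 : ℝ) 0 f) n =
      fourierCoeffOn (zero_lt_one' ℝ) f n := by
    intro f n
    rw [fourierCoeffOn_eq_integral, fourierCoeff_liftIco_eq, fourierCoeffOn_eq_integral]
    simp
  have hL2 : MemLp f' 2 (volume.restrict (Set.Ioc 0 1)) := by
    obtain ⟨M, hM⟩ :=
      isCompact_Icc.exists_bound_of_continuousOn (hf'.continuousOn (s := Set.Icc 0 1))
    refine MemLp.of_bound hf'.aestronglyMeasurable M ?_
    filter_upwards [ae_restrict_mem measurableSet_Ioc] with x hx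
    exact hM x (Set.Ioc_subset_Icc_self hx)
  have hs := (hasSum_sq_fourierCoeffOn (zero_lt_one' ℝ) hL2).summable
  have hz : Summable fun n : ℤ => 1 / (n : ℝ) ^ 2 :=
    Real.summable_one_div_int_pow.2 one_lt_two
  refine Summable.of_norm_bounded_eventually ((hz.add hs)) ?_
  have hne : ∀ᶠ n : ℤ in cofinite, n ≠ 0 := by
    simpa using (Set.finite_singleton (0 : ℤ)).eventually_cofinite_notMem
  filter_upwards [hne] with n hn
  rw [e1, fourierCoeffOn_of_hasDerivAt (zero_lt_one' ℝ) hn (fun x _ => hf x)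
    (hf'.intervalIntegrable _ _), h01, sub_self, mul_zero, zero_sub]
  set y := fourierCoeffOn (zero_lt_one' ℝ) f' n with hy
  have hn0 : (0 : ℝ) < |(n : ℝ)| := by positivity
  have h2 : ‖1 / (-2 * (Real.pi : ℂ) * Complex.I * n) * -(((1 : ℝ) - (0 : ℝ) : ℂ) * y)‖
      = 1 / (2 * Real.pi) * (1 / |(n : ℝ)| * ‖y‖) := by
    simp [abs_of_pos Real.pi_pos]
    ring
  rw [h2]
  have h3 : 1 / (2 * Real.pi) ≤ 1 := by
    rw [div_le_one (by positivity)]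
    linarith [Real.pi_gt_three]
  have h4 : 1 / (n : ℝ) ^ 2 = (1 / |(n : ℝ)|) ^ 2 := by simp
  have h5 : 0 ≤ 1 / |(n : ℝ)| * ‖y‖ := by positivity
  rw [h4]
  nlinarith [sq_nonneg (1 / |(n : ℝ)| - ‖y‖), mul_le_mul_of_nonneg_right h3 h5]

/-- A continuously differentiable function with `f 0 = f 1` is the sum on `[0, 1]` of an absolutely
convergent Fourier series. The derivative may take different values at the two end points. -/
theorem exists_hasSum_fourier {f f' : ℝ → ℂ} (hf : ∀ x, HasDerivAt f (f' x) x)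
    (hf' : Continuous f') (h01 : f 0 = f 1) :
    ∃ d : ℤ → ℂ, Summable d ∧ ∀ x ∈ Set.Ico (0 : ℝ) 1,
      HasSum (fun k : ℤ => d k * fourier k (x : UnitAddCircle)) (f x) := by
  have hc : Continuous f := continuous_iff_continuousAt.2 fun x => (hf x).continuousAt
  let F : C(UnitAddCircle, ℂ) := ⟨_, continuous_liftIco_unit hc h01⟩
  have hs : Summable (fourierCoeff F) := summable_fourierCoeff_liftIco hf hf' h01
  refine ⟨fourierCoeff F, hs, fun x hx => ?_⟩
  have h1 : F (x : UnitAddCircle) = f x := AddCircle.liftIco_zero_coe_apply hx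
  simpa [h1] using has_pointwise_sum_fourier_series_of_summable hs (x : UnitAddCircle)

/-- Only the values of `1 / periodize h` on one period are needed, where it may be given by a smooth
expression `f` which is not itself periodic. -/
theorem exists_inv_series {h f f' : ℝ → ℝ} (hf : ∀ x, HasDerivAt f (f' x) x)
    (hf' : Continuous f') (h01 : f 0 = f 1)
    (heq : ∀ x ∈ Set.Ico (0 : ℝ) 1, f x = (periodize h x)⁻¹) :
    ∃ d : ℤ → ℂ, Summable d ∧ ∀ x : ℝ,
      HasSum (fun k : ℤ => d k * fourier k (x : UnitAddCircle))
        (((periodize h x)⁻¹ : ℝ) : ℂ) := by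
  obtain ⟨d, hd, hs⟩ := exists_hasSum_fourier (f := fun x => (f x : ℂ)) (f' := fun x => (f' x : ℂ))
    (fun x => (hf x).ofReal_comp) (Complex.continuous_ofReal.comp hf') (by rw [h01])
  refine ⟨d, hd, fun x => ?_⟩
  have h1 := hs (Int.fract x) ⟨Int.fract_nonneg x, Int.fract_lt_one x⟩
  rw [heq _ ⟨Int.fract_nonneg x, Int.fract_lt_one x⟩] at h1
  have h2 : ((Int.fract x : ℝ) : UnitAddCircle) = x := by
    rw [← Int.self_sub_floor]
    simp
  have h3 : periodize h (Int.fract x) = periodize h x := by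
    rw [← periodize_add_int h (Int.fract x) ⌊x⌋, Int.fract_add_floor]
  rwa [h2, h3] at h1

/-! ### The Fourier transform on the line -/

/-- Plancherel's identity for integrable continuous functions with integrable transform. -/
theorem integral_norm_sq_fourier_of_integrable {g : ℝ → ℂ} (hc : Continuous g)
    (hg : Integrable g) (hFg : Integrable (𝓕 g)) :
    ∫ t, ‖𝓕 g t‖ ^ 2 = ∫ x, ‖g x‖ ^ 2 := by
  have key : ∫ t, inner ℂ (𝓕 g t) (𝓕 g t) = ∫ x, inner ℂ (g x) (𝓕⁻ (𝓕 g) x) := by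
    simpa only [flip_innerₗ] using! VectorFourier.integral_sesq_fourierIntegral_eq_neg_flip
      (innerSL ℂ) (L := innerₗ ℝ) Real.continuous_fourierChar continuous_inner hg hFg
  rw [hc.fourierInv_fourier_eq hg hFg] at key
  apply Complex.ofRealLI.injective
  simpa [← LinearIsometry.integral_comp_comm, inner_self_eq_norm_sq_to_K] using key

theorem norm_fourier_le_integral_norm (g : ℝ → ℂ) (t : ℝ) : ‖𝓕 g t‖ ≤ ∫ x, ‖g x‖ :=
  VectorFourier.norm_fourierIntegral_le_integral_norm _ _ _ _ _

theorem continuous_fourier_of_integrable {g : ℝ → ℂ} (hg : Integrable g) : Continuous (𝓕 g) :=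
  VectorFourier.fourierIntegral_continuous Real.continuous_fourierChar continuous_inner hg

theorem norm_fourier_apply (k : ℤ) (x : UnitAddCircle) : ‖fourier k x‖ = 1 := by
  rw [fourier_apply, Circle.norm_coe]

theorem integrable_fourier_mul {g : ℝ → ℂ} (hg : Integrable g) (k : ℤ) :
    Integrable fun x : ℝ => fourier k (x : UnitAddCircle) * g x :=
  hg.bdd_mul (c := 1) (((fourier k).continuous.comp
    (AddCircle.continuous_mk' 1)).aestronglyMeasurable) (ae_of_all _ fun _ =>
      (norm_fourier_apply k _).le)

theorem fourier_mul_fourier_eq_shift (g : ℝ → ℂ) (k : ℤ) (t : ℝ) :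
    𝓕 (fun x : ℝ => fourier k (x : UnitAddCircle) * g x) t = 𝓕 g (t - k) := by
  rw [Real.fourier_real_eq_integral_exp_smul, Real.fourier_real_eq_integral_exp_smul]
  congr with x
  rw [fourier_coe_apply, smul_eq_mul, smul_eq_mul, ← mul_assoc, ← Complex.exp_add]
  congr 2
  push_cast
  ring

theorem fourier_const_mul (a : ℂ) (g : ℝ → ℂ) (t : ℝ) :
    𝓕 (fun x => a * g x) t = a * 𝓕 g t := by
  simp only [Real.fourier_real_eq_integral_exp_smul, ← integral_const_mul, smul_eq_mul,
    mul_left_comm]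

theorem unitaryFourier_eq_fourier (ψ : ℝ → ℂ) (ω : ℝ) :
    unitaryFourier ψ ω = (1 / Real.sqrt (2 * Real.pi) : ℝ) * 𝓕 ψ (ω / (2 * Real.pi)) := by
  rw [unitaryFourier, Real.fourier_real_eq_integral_exp_smul]
  congr 2 with x
  rw [smul_eq_mul, mul_comm]
  congr 2
  have := Real.pi_ne_zero
  push_cast
  field_simp

/-! ### Riesz constants of systems with a continuous symbol -/

/-- The trigonometric polynomial `∑ c k e^{2πikx}`, `k ∈ F`. -/
noncomputable def trigPoly (F : Finset ℤ) (c : ℤ → ℂ) : C(UnitAddCircle, ℂ) :=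
  ∑ k ∈ F, c k • fourier k

theorem trigPoly_apply (F : Finset ℤ) (c : ℤ → ℂ) (x : UnitAddCircle) :
    trigPoly F c x = ∑ k ∈ F, c k * fourier k x := by
  simp [trigPoly, ContinuousMap.sum_apply]

theorem dense_range_trigPoly :
    Dense {g : C(UnitAddCircle, ℂ) | ∃ F c, g = trigPoly F c} := by
  have h := span_fourier_closure_eq_top (T := 1)
  rw [← Submodule.dense_iff_topologicalClosure_eq_top] at h
  refine h.mono fun g hg => ?_
  obtain ⟨c, rfl⟩ := (Finsupp.mem_span_range_iff_exists_finsupp).1 hg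
  exact ⟨c.support, c, rfl⟩

theorem integral_norm_sq_trigPoly (F : Finset ℤ) (c : ℤ → ℂ) :
    ∫ x, ‖trigPoly F c x‖ ^ 2 = ∑ k ∈ F, ‖c k‖ ^ 2 := by
  have horth := orthonormal_fourier (T := 1)
  have h1 := horth.inner_sum c c F
  have h2 : ∑ k ∈ F, c k • fourierLp (T := 1) 2 k
      = ContinuousMap.toLp (E := ℂ) 2 AddCircle.haarAddCircle ℂ (trigPoly F c) := by
    simp [trigPoly, fourierLp]
  rw [h2, ContinuousMap.inner_toLp] at h1
  apply Complex.ofRealLI.injective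
  have h3 : (volume : Measure UnitAddCircle) = AddCircle.haarAddCircle := by
    simp [AddCircle.volume_eq_smul_haarAddCircle]
  rw [h3]
  simpa [← LinearIsometry.integral_comp_comm, Complex.mul_conj, Complex.conj_mul',
    Complex.mul_conj', Complex.normSq_eq_norm_sq] using h1

/-- A weight is nonnegative if its integral against every `‖g‖²`, `g` a trigonometric polynomial,
is. -/
theorem nonneg_of_forall_trigPoly {Q : C(UnitAddCircle, ℝ)}
    (h : ∀ F c, 0 ≤ ∫ x, ‖trigPoly F c x‖ ^ 2 * Q x) (x : UnitAddCircle) : 0 ≤ Q x := by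
  have hcont : Continuous fun g : C(UnitAddCircle, ℂ) => ∫ x, ‖g x‖ ^ 2 * Q x := by
    have : Continuous fun g : C(UnitAddCircle, ℂ) =>
        ContinuousMap.toLp (E := ℝ) 1 (volume : Measure UnitAddCircle) ℝ
          (⟨fun x => ‖g x‖ ^ 2 * Q x, by fun_prop⟩) := by
      refine (ContinuousLinearMap.continuous _).comp ?_
      refine ContinuousMap.continuous_of_continuous_uncurry _ ?_
      simp only [Function.uncurry_def, ContinuousMap.coe_mk]
      fun_prop
    refine (continuous_integral.comp this).congr fun g => ?_
    exact integral_congr_ae (ContinuousMap.coeFn_toLp _ _)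
  have hall : ∀ g : C(UnitAddCircle, ℂ), 0 ≤ ∫ x, ‖g x‖ ^ 2 * Q x := by
    intro g
    refine dense_range_trigPoly.induction (P := fun g => 0 ≤ ∫ x, ‖g x‖ ^ 2 * Q x) ?_
      (isClosed_Ici.preimage hcont) g
    rintro _ ⟨F, c, rfl⟩
    exact h F c
  -- test with the square root of the negative part of `Q`
  have hg := hall ⟨fun x => ((Real.sqrt (max (-Q x) 0) : ℝ) : ℂ), by fun_prop⟩
  have hle : ∀ x, ‖((Real.sqrt (max (-Q x) 0) : ℝ) : ℂ)‖ ^ 2 * Q x = -(max (-Q x) 0) ^ 2 := by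
    intro x
    rw [Complex.norm_real, Real.norm_eq_abs, sq_abs, Real.sq_sqrt (le_max_right _ _)]
    rcases le_total (-Q x) 0 with h0 | h0
    · simp [max_eq_right h0]
    · rw [max_eq_left h0]; ring
  simp only [ContinuousMap.coe_mk, hle, integral_neg] at hg
  have hc2 : Continuous fun x => (max (-Q x) 0) ^ 2 := by fun_prop
  have h0 : ∫ x, (max (-Q x) 0) ^ 2 = 0 :=
    le_antisymm (by linarith) (integral_nonneg fun x => sq_nonneg _)
  rw [integral_eq_zero_iff_of_nonneg (fun x => sq_nonneg _)
    (hc2.integrable_of_hasCompactSupport (HasCompactSupport.of_compactSpace _))] at h0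
  have h1 := (hc2.ae_eq_iff_eq volume continuous_zero).1 h0
  have h2 := congrFun h1 x
  simp only [Pi.zero_apply, pow_eq_zero_iff two_ne_zero, max_eq_right_iff] at h2
  linarith

/-- The Riesz bounds of a system are exactly the bounds of its symbol. -/
theorem hasRieszBounds_iff {f : ℤ → ℝ → ℂ} (hf : ∀ k, MemLp (f k) 2 (volume : Measure ℝ))
    (P : C(UnitAddCircle, ℝ))
    (hP : ∀ (F : Finset ℤ) (c : ℤ → ℂ),
      ‖∑ k ∈ F, c k • (hf k).toLp (f k)‖ ^ 2 = ∫ x, ‖trigPoly F c x‖ ^ 2 * P x) {A B : ℝ} :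
    HasRieszBounds f A B ↔ ∀ x, A ≤ P x ∧ P x ≤ B := by
  have hint : ∀ (F : Finset ℤ) (c : ℤ → ℂ) (Q : C(UnitAddCircle, ℝ)),
      Integrable fun x => ‖trigPoly F c x‖ ^ 2 * Q x := fun F c Q =>
    Continuous.integrable_of_hasCompactSupport (by fun_prop) (HasCompactSupport.of_compactSpace _)
  have hconst : ∀ (F : Finset ℤ) (c : ℤ → ℂ) (K : ℝ),
      ∫ x, ‖trigPoly F c x‖ ^ 2 * K = K * ∑ k ∈ F, ‖c k‖ ^ 2 := fun F c K => by
    rw [integral_mul_const, integral_norm_sq_trigPoly, mul_comm]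
  constructor
  · rintro ⟨hf', h⟩
    -- for finitely supported coefficients the sum of the series is the finite sum
    have hfin : ∀ (F : Finset ℤ) (c : ℤ → ℂ),
        A * ∑ k ∈ F, ‖c k‖ ^ 2 ≤ ∫ x, ‖trigPoly F c x‖ ^ 2 * P x ∧
          ∫ x, ‖trigPoly F c x‖ ^ 2 * P x ≤ B * ∑ k ∈ F, ‖c k‖ ^ 2 := by
      intro F c
      obtain ⟨s, hs, h1, h2⟩ := h (∑ k ∈ F, lp.single 2 k (c k))
      have hcoe : ∀ k, (∑ k ∈ F, lp.single 2 k (c k) : lp (fun _ : ℤ => ℂ) 2) k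
          = if k ∈ F then c k else 0 := by
        intro k
        rw [lp.coeFn_sum, Finset.sum_apply]
        simp [Pi.single_apply]
      have hs' : HasSum (fun k : ℤ => (∑ k ∈ F, lp.single 2 k (c k) : lp (fun _ : ℤ => ℂ) 2) k •
          (hf' k).toLp (f k)) (∑ k ∈ F, c k • (hf k).toLp (f k)) := by
        have := hasSum_sum_of_ne_finset_zero (s := F) (L := .unconditional ℤ) (f := fun k : ℤ =>
          (∑ k ∈ F, lp.single 2 k (c k) : lp (fun _ : ℤ => ℂ) 2) k • (hf' k).toLp (f k))
          fun k hk => by rw [hcoe, if_neg hk, zero_smul]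
        convert this using 1
        refine Finset.sum_congr rfl fun k hk => ?_
        rw [hcoe, if_pos hk]
      have hn : ‖(∑ k ∈ F, lp.single 2 k (c k) : lp (fun _ : ℤ => ℂ) 2)‖ ^ 2
          = ∑ k ∈ F, ‖c k‖ ^ 2 := by
        have := lp.norm_sum_single (E := fun _ : ℤ => ℂ) (p := 2) (by norm_num) c F
        simpa using this
      rw [hs.unique hs', hn, hP] at h1 h2
      exact ⟨h1, h2⟩
    intro x
    constructor
    · have := nonneg_of_forall_trigPoly (Q := P - ContinuousMap.const _ A) (fun F c => by
        simp only [ContinuousMap.sub_apply, ContinuousMap.const_apply, mul_sub]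
        refine le_of_le_of_eq ?_
          (integral_sub (hint F c P) (hint F c (ContinuousMap.const _ A))).symm
        simp only [ContinuousMap.const_apply, hconst]
        linarith [(hfin F c).1]) x
      simpa using this
    · have := nonneg_of_forall_trigPoly (Q := ContinuousMap.const _ B - P) (fun F c => by
        simp only [ContinuousMap.sub_apply, ContinuousMap.const_apply, mul_sub]
        refine le_of_le_of_eq ?_
          (integral_sub (hint F c (ContinuousMap.const _ B)) (hint F c P)).symm
        simp only [ContinuousMap.const_apply, hconst]
        linarith [(hfin F c).2]) x
      simpa using this
  · intro h
    have hlow : ∀ (F : Finset ℤ) (c : ℤ → ℂ),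
        A * ∑ k ∈ F, ‖c k‖ ^ 2 ≤ ‖∑ k ∈ F, c k • (hf k).toLp (f k)‖ ^ 2 := by
      intro F c
      rw [hP, ← hconst]
      refine integral_mono (hint F c (ContinuousMap.const _ A)) (hint F c P) fun x => ?_
      exact mul_le_mul_of_nonneg_left (h x).1 (sq_nonneg _)
    have hup : ∀ (F : Finset ℤ) (c : ℤ → ℂ),
        ‖∑ k ∈ F, c k • (hf k).toLp (f k)‖ ^ 2 ≤ B * ∑ k ∈ F, ‖c k‖ ^ 2 := by
      intro F c
      rw [hP, ← hconst]
      refine integral_mono (hint F c P) (hint F c (ContinuousMap.const _ B)) fun x => ?_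
      exact mul_le_mul_of_nonneg_left (h x).2 (sq_nonneg _)
    refine ⟨hf, fun c => ?_⟩
    have hc : HasSum (fun k => ‖c k‖ ^ 2) (‖c‖ ^ 2) := by
      simpa using lp.hasSum_norm (p := 2) (by norm_num) c
    -- the upper bound for finite sums gives Cauchy's criterion
    have hsum : Summable fun k : ℤ => c k • (hf k).toLp (f k) := by
      rw [summable_iff_vanishing_norm]
      intro ε hε
      obtain ⟨s, hs⟩ := summable_iff_vanishing_norm.1 hc.summable (ε ^ 2 / (|B| + 1))
        (by positivity)
      refine ⟨s, fun t ht => ?_⟩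
      have h1 := hs t ht
      rw [Real.norm_of_nonneg (Finset.sum_nonneg fun _ _ => sq_nonneg _),
        lt_div_iff₀ (by positivity)] at h1
      have h2 := hup t c
      have h3 : (0 : ℝ) ≤ ∑ k ∈ t, ‖c k‖ ^ 2 := Finset.sum_nonneg fun _ _ => sq_nonneg _
      have h4 : B * ∑ k ∈ t, ‖c k‖ ^ 2 ≤ |B| * ∑ k ∈ t, ‖c k‖ ^ 2 :=
        mul_le_mul_of_nonneg_right (le_abs_self B) h3
      refine lt_of_pow_lt_pow_left₀ 2 hε.le ?_
      nlinarith
    obtain ⟨s, hs⟩ := hsum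
    have hs2 : Tendsto (fun F : Finset ℤ => ‖∑ k ∈ F, c k • (hf k).toLp (f k)‖ ^ 2) atTop
        (𝓝 (‖s‖ ^ 2)) := (Filter.Tendsto.norm hs).pow 2
    exact ⟨s, hs, le_of_tendsto_of_tendsto' (Filter.Tendsto.const_mul A hc) hs2 fun F => hlow F c,
      le_of_tendsto_of_tendsto' hs2 (Filter.Tendsto.const_mul B hc) fun F => hup F c⟩

section constants

variable {f : ℤ → ℝ → ℂ} {P : C(UnitAddCircle, ℝ)}

theorem isRieszSystem_of_iff (hP : ∀ A B, HasRieszBounds f A B ↔ ∀ x, A ≤ P x ∧ P x ≤ B)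
    (hpos : ∀ x, 0 < P x) : IsRieszSystem f := by
  obtain ⟨a, -, ha⟩ := isCompact_univ.exists_isMinOn Set.univ_nonempty P.continuous.continuousOn
  obtain ⟨b, -, hb⟩ := isCompact_univ.exists_isMaxOn Set.univ_nonempty P.continuous.continuousOn
  exact ⟨P a, P b, hpos a, hpos b,
    (hP _ _).2 fun x => ⟨ha (Set.mem_univ x), hb (Set.mem_univ x)⟩⟩

theorem lowerRieszConstant_eq (hP : ∀ A B, HasRieszBounds f A B ↔ ∀ x, A ≤ P x ∧ P x ≤ B)
    (hpos : ∀ x, 0 < P x) {a : UnitAddCircle} (ha : ∀ x, P a ≤ P x) :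
    lowerRieszConstant f = P a := by
  have hR := isRieszSystem_of_iff hP hpos
  obtain ⟨⟨_, B, hB0, hB⟩, hmax⟩ := hR.isGreatest
  refine le_antisymm (((hP _ _).1 hB) a).1 (hmax ⟨hpos a, B, hB0, (hP _ _).2 fun x => ?_⟩)
  exact ⟨ha x, ((hP _ _).1 hB x).2⟩

theorem upperRieszConstant_eq (hP : ∀ A B, HasRieszBounds f A B ↔ ∀ x, A ≤ P x ∧ P x ≤ B)
    (hpos : ∀ x, 0 < P x) {b : UnitAddCircle} (hb : ∀ x, P x ≤ P b) :
    upperRieszConstant f = P b := by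
  have hR := isRieszSystem_of_iff hP hpos
  obtain ⟨⟨_, A, hA0, hA⟩, hmin⟩ := hR.isLeast
  refine le_antisymm (hmin ⟨hpos b, A, hA0, (hP _ _).2 fun x => ?_⟩) (((hP _ _).1 hA) b).2
  exact ⟨((hP _ _).1 hA x).1, hb x⟩

theorem exists_upperRieszConstant_eq
    (hP : ∀ A B, HasRieszBounds f A B ↔ ∀ x, A ≤ P x ∧ P x ≤ B)
    (hpos : ∀ x, 0 < P x) : ∃ b, upperRieszConstant f = P b ∧ ∀ x, P x ≤ P b := by
  obtain ⟨b, -, hb⟩ := isCompact_univ.exists_isMaxOn Set.univ_nonempty P.continuous.continuousOn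
  exact ⟨b, upperRieszConstant_eq hP hpos fun x => hb (Set.mem_univ x),
    fun x => hb (Set.mem_univ x)⟩

end constants

/-! ### The nod function of a function with a positive spectral density -/

/-- `h` is the (positive, even, exponentially decaying) spectral density of `φ`: the function `φ`
is the Fourier transform of `h`, and the reciprocal of the periodization of `h` has an absolutely
convergent Fourier series. -/
structure IsSpectralDensity (φ : ℝ → ℂ) (h : ℝ → ℝ) : Prop where
  continuous : Continuous h
  pos : ∀ x, 0 < h x
  even : ∀ x, h (-x) = h x
  decay : HasExpDecay h
  fourier_eq : 𝓕 (fun x => (h x : ℂ)) = φ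
  integrable : Integrable φ
  summable : Summable fun m : ℤ => φ m
  inv_series : ∃ d : ℤ → ℂ, Summable d ∧ ∀ x : ℝ,
    HasSum (fun k : ℤ => d k * fourier k (x : UnitAddCircle)) (((periodize h x)⁻¹ : ℝ) : ℂ)

/-- The density `h / ∑ h (· + n)`, whose Fourier transform is the nod function. Its integer
translates sum to `1`. -/
noncomputable def nodDensity (h : ℝ → ℝ) (x : ℝ) : ℝ := h x / periodize h x

/-- The symbol `∑ h (· + n)² / (∑ h (· + n))²` of the shifts of the nod function. -/
noncomputable def nodSymbol (h : ℝ → ℝ) (x : ℝ) : ℝ :=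
  periodize (fun y => h y ^ 2) x / periodize h x ^ 2

theorem nodSymbol_add_one (h : ℝ → ℝ) (x : ℝ) : nodSymbol h (x + 1) = nodSymbol h x := by
  simp only [nodSymbol, periodize_add_one]

namespace IsSpectralDensity

variable {φ : ℝ → ℂ} {h : ℝ → ℝ}

theorem periodize_pos (H : IsSpectralDensity φ h) (x : ℝ) : 0 < periodize h x :=
  H.decay.periodize_pos H.pos x

theorem continuous_nodDensity (H : IsSpectralDensity φ h) : Continuous (nodDensity h) :=
  H.continuous.div (H.decay.continuous_periodize H.continuous) fun x => (H.periodize_pos x).ne'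

theorem integrable_nodDensity (H : IsSpectralDensity φ h) : Integrable (nodDensity h) := by
  obtain ⟨d, hd, hs⟩ := H.inv_series
  refine ((H.decay.integrable H.continuous).const_mul (∑' k, ‖d k‖)).mono'
    H.continuous_nodDensity.aestronglyMeasurable (ae_of_all _ fun x => ?_)
  have h1 : ‖(((periodize h x)⁻¹ : ℝ) : ℂ)‖ ≤ ∑' k, ‖d k‖ := by
    rw [← (hs x).tsum_eq]
    refine (norm_tsum_le_tsum_norm ?_).trans_eq ?_ <;>
      simp only [norm_mul, norm_fourier_apply, mul_one, hd.norm]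
  rw [Complex.norm_real] at h1
  rw [nodDensity, div_eq_inv_mul, norm_mul, Real.norm_of_nonneg (H.pos x).le]
  exact mul_le_mul_of_nonneg_right h1 (H.pos x).le

theorem integrable_ofReal_nodDensity (H : IsSpectralDensity φ h) :
    Integrable fun x => (nodDensity h x : ℂ) := H.integrable_nodDensity.ofReal

theorem hasSum_nodDensity (H : IsSpectralDensity φ h) (x : ℝ) :
    HasSum (fun n : ℤ => nodDensity h (x + n)) 1 := by
  have := (H.decay.summable x).hasSum.div_const (periodize h x)
  simp only [nodDensity, periodize_add_int]
  rwa [← periodize, div_self (H.periodize_pos x).ne'] at this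

theorem hasSum_nodDensity_sq (H : IsSpectralDensity φ h) (x : ℝ) :
    HasSum (fun n : ℤ => nodDensity h (x + n) ^ 2) (nodSymbol h x) := by
  have := (H.decay.sq.summable x).hasSum.div_const (periodize h x ^ 2)
  simp only [nodDensity, periodize_add_int, div_pow]
  exact this

theorem continuous_nodSymbol (H : IsSpectralDensity φ h) : Continuous (nodSymbol h) :=
  (H.decay.sq.continuous_periodize (H.continuous.pow 2)).div
    ((H.decay.continuous_periodize H.continuous).pow 2)
    fun x => (pow_pos (H.periodize_pos x) 2).ne'

theorem nodSymbol_pos (H : IsSpectralDensity φ h) (x : ℝ) : 0 < nodSymbol h x :=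
  div_pos (H.decay.sq.periodize_pos (fun x => pow_pos (H.pos x) 2) x)
    (pow_pos (H.periodize_pos x) 2)

/-- The nod symbol as a function on the circle. -/
noncomputable def circleSymbol (H : IsSpectralDensity φ h) : C(UnitAddCircle, ℝ) where
  toFun := Function.Periodic.lift (f := nodSymbol h) (c := 1) (nodSymbol_add_one h)
  continuous_toFun := continuous_coinduced_dom.2 H.continuous_nodSymbol

theorem circleSymbol_coe (H : IsSpectralDensity φ h) (x : ℝ) :
    H.circleSymbol (x : UnitAddCircle) = nodSymbol h x := rfl

/-- Multiplying the Fourier series of `1 / periodize h` by `h` and transforming term by term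
exhibits the transform of the nod density as a combination of the translates of `φ`. -/
theorem hasSum_fourier_nodDensity (H : IsSpectralDensity φ h) {d : ℤ → ℂ} (hd : Summable d)
    (hs : ∀ x : ℝ,
      HasSum (fun k : ℤ => d k * fourier k (x : UnitAddCircle)) (((periodize h x)⁻¹ : ℝ) : ℂ))
    (t : ℝ) :
    HasSum (fun k : ℤ => d k * φ (t - k)) (𝓕 (fun x => (nodDensity h x : ℂ)) t) := by
  have hh : Integrable fun x => (h x : ℂ) := (H.decay.integrable H.continuous).ofReal
  have key := hasSum_integral_of_summable_integral_norm (μ := (volume : Measure ℝ))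
    (F := fun (k : ℤ) (x : ℝ) => Complex.exp ((-2 * Real.pi * x * t : ℝ) * Complex.I) *
      (d k * (fourier k (x : UnitAddCircle) * (h x : ℂ)))) ?_ ?_
  · convert! key using 1
    · ext k
      rw [← H.fourier_eq, ← fourier_mul_fourier_eq_shift, Real.fourier_real_eq_integral_exp_smul,
        ← integral_const_mul]
      congr with x
      rw [smul_eq_mul]
      ring
    · rw [Real.fourier_real_eq_integral_exp_smul]
      congr with x
      have h1 := ((hs x).mul_right (h x : ℂ)).mul_left
        (Complex.exp ((-2 * Real.pi * x * t : ℝ) * Complex.I))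
      simp only [mul_assoc] at h1 ⊢
      rw [h1.tsum_eq, nodDensity, div_eq_inv_mul, smul_eq_mul]
      simp
  · intro k
    exact ((integrable_fourier_mul hh k).const_mul (d k)).bdd_mul (c := 1)
      (Continuous.aestronglyMeasurable (by fun_prop))
      (ae_of_all _ fun x => (Complex.norm_exp_ofReal_mul_I _).le)
  · have h1 : ∀ (k : ℤ) (x : ℝ), ‖Complex.exp ((-2 * Real.pi * x * t : ℝ) * Complex.I) *
        (d k * (fourier k (x : UnitAddCircle) * (h x : ℂ)))‖ = ‖d k‖ * ‖(h x : ℂ)‖ := by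
      intro k x
      rw [norm_mul, norm_mul, norm_mul, Complex.norm_exp_ofReal_mul_I, norm_fourier_apply, one_mul,
        one_mul]
    simp only [h1, integral_const_mul]
    exact hd.norm.mul_right _

theorem continuous_fourier_nodDensity (H : IsSpectralDensity φ h) :
    Continuous (𝓕 (fun x => (nodDensity h x : ℂ))) :=
  continuous_fourier_of_integrable H.integrable_nodDensity.ofReal

theorem integrable_fourier_nodDensity (H : IsSpectralDensity φ h) :
    Integrable (𝓕 (fun x => (nodDensity h x : ℂ))) := by
  obtain ⟨d, hd, hs⟩ := H.inv_series
  refine ⟨H.continuous_fourier_nodDensity.aestronglyMeasurable, ?_⟩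
  have hle : ∀ t, ‖𝓕 (fun x => (nodDensity h x : ℂ)) t‖ₑ ≤ ∑' k : ℤ, ‖d k‖ₑ * ‖φ (t - k)‖ₑ := by
    intro t
    rw [← (H.hasSum_fourier_nodDensity hd hs t).tsum_eq]
    refine enorm_tsum_le_tsum_enorm.trans_eq ?_
    simp only [enorm_mul]
  refine (lintegral_mono hle).trans_lt ?_
  rw [lintegral_tsum (f := fun (k : ℤ) t => ‖d k‖ₑ * ‖φ (t - k)‖ₑ)
    fun k => ((H.integrable.comp_sub_right (k : ℝ)).1.enorm.const_mul _)]
  have h1 : ∀ k : ℤ, ∫⁻ t, ‖d k‖ₑ * ‖φ (t - k)‖ₑ = ‖d k‖ₑ * ∫⁻ t, ‖φ t‖ₑ := by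
    intro k
    rw [lintegral_const_mul' _ _ enorm_ne_top, lintegral_sub_right_eq_self (fun t => ‖φ t‖ₑ)]
  simp only [h1, ENNReal.tsum_mul_right]
  refine ENNReal.mul_lt_top ?_ H.integrable.2
  exact (tsum_enorm_ne_top_iff_summable_norm.2 hd.norm).lt_top

/-- Unfolding the integral at an integer `m` leaves the `m`-th Fourier coefficient of the constant
`1 = ∑ nodDensity h (· + n)`. -/
theorem fourier_nodDensity_int (H : IsSpectralDensity φ h) (m : ℤ) :
    𝓕 (fun x => (nodDensity h x : ℂ)) m = if m = 0 then 1 else 0 := by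
  have hint := integrable_fourier_mul H.integrable_ofReal_nodDensity (-m)
  have h1 : 𝓕 (fun x => (nodDensity h x : ℂ)) m
      = ∫ x : ℝ, fourier (-m) (x : UnitAddCircle) * (nodDensity h x : ℂ) := by
    rw [Real.fourier_real_eq_integral_exp_smul]
    congr with x
    rw [fourier_coe_apply, smul_eq_mul]
    congr 2
    push_cast
    ring
  have h2 : ∀ x : ℝ, ∑' n : ℤ, fourier (-m) ((x + n : ℝ) : UnitAddCircle) *
      (nodDensity h (x + n) : ℂ) = fourier (-m) (x : UnitAddCircle) := by
    intro x
    have h3 : ∀ n : ℤ, ((x + n : ℝ) : UnitAddCircle) = x := fun n => by simp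
    simp only [h3]
    rw [tsum_mul_left, ← Complex.ofReal_tsum, (H.hasSum_nodDensity x).tsum_eq]
    simp
  rw [h1, integral_eq_intervalIntegral_tsum hint]
  simp only [h2]
  -- the constant `1` is the character `fourier 0`
  have h4 := fourierCoeff_eq_intervalIntegral (T := 1) (fourier 0 : UnitAddCircle → ℂ) m 0
  rw [fourierCoeff_fourier] at h4
  simpa [Pi.single_apply] using h4.symm

theorem isNodFunction_fourier (H : IsSpectralDensity φ h) :
    IsNodFunction φ (𝓕 (fun x => (nodDensity h x : ℂ))) := by
  obtain ⟨d, hd, hs⟩ := H.inv_series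
  refine ⟨⟨d, ?_, H.hasSum_fourier_nodDensity hd hs⟩, H.fourier_nodDensity_int⟩
  exact (memℓp_gen (by simpa using hd.norm) : Memℓp d 1).of_exponent_ge one_le_two

end IsSpectralDensity

/-! ### Uniqueness and Riesz constants of the nod function -/

/-- An absolutely summable convolution inverse is the only bounded one. -/
theorem eq_of_forall_hasSum_convolution {a d d' : ℤ → ℂ} (ha : Summable a) (hd : Summable d)
    (hd' : ∃ M, ∀ k, ‖d' k‖ ≤ M)
    (h : ∀ m : ℤ, HasSum (fun k => d k * a (m - k)) (if m = 0 then 1 else 0))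
    (h' : ∀ m : ℤ, HasSum (fun k => d' k * a (m - k)) (if m = 0 then 1 else 0)) : d' = d := by
  obtain ⟨M, hM⟩ := hd'
  ext n
  -- both sides are iterated sums of the double series `∑ d' k * d j * a (n - k - j)`
  have hs : Summable (Function.uncurry fun k j : ℤ => d' k * (d j * a (n - k - j))) := by
    have h1 := (summable_mul_of_summable_norm hd.norm ha.norm).norm.mul_left M
    let e : ℤ × ℤ ≃ ℤ × ℤ :=
      { toFun := fun p => (p.2, n - p.1 - p.2)
        invFun := fun p => (n - p.1 - p.2, p.1)
        left_inv := fun p => by ext <;> simp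
        right_inv := fun p => by ext <;> (simp; try ring) }
    refine Summable.of_norm_bounded (e.summable_iff.2 h1) fun p => ?_
    simp only [Function.uncurry, Function.comp, e, Equiv.coe_fn_mk]
    rw [norm_mul]
    exact mul_le_mul_of_nonneg_right (hM _) (norm_nonneg _)
  have hcomm := hs.tsum_comm
  have h1 : ∀ k, ∑' j, d' k * (d j * a (n - k - j)) = d' k * if n = k then 1 else 0 := by
    intro k
    rw [tsum_mul_left, (h (n - k)).tsum_eq]
    simp only [sub_eq_zero]
  have h2 : ∀ j, ∑' k, d' k * (d j * a (n - k - j)) = d j * if n = j then 1 else 0 := by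
    intro j
    have h3 := ((h' (n - j)).mul_left (d j)).tsum_eq
    simp only [sub_eq_zero] at h3
    rw [← h3]
    refine tsum_congr fun k => ?_
    rw [sub_right_comm]
    ring
  simp only [h1, h2, mul_ite, mul_one, mul_zero] at hcomm
  simpa using hcomm.symm

theorem norm_sq_Lp_two (s : Lp ℂ 2 (volume : Measure ℝ)) : ‖s‖ ^ 2 = ∫ t, ‖s t‖ ^ 2 := by
  have h := congr_arg RCLike.re (L2.inner_def (𝕜 := ℂ) s s)
  rw [← integral_re (L2.integrable_inner s s)] at h
  simpa only [← norm_sq_eq_re_inner] using h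

namespace IsSpectralDensity

variable {φ ψ : ℝ → ℂ} {h : ℝ → ℝ}

theorem eq_fourier_nodDensity (H : IsSpectralDensity φ h) (hψ : IsNodFunction φ ψ) :
    ψ = 𝓕 (fun x => (nodDensity h x : ℂ)) := by
  obtain ⟨⟨d', hd', hs'⟩, hm'⟩ := hψ
  obtain ⟨d, hd, hs⟩ := H.inv_series
  have hbd : ∃ M, ∀ k, ‖d' k‖ ≤ M := by
    obtain ⟨M, hM⟩ := (hd'.of_exponent_ge le_top).bddAbove
    exact ⟨M, fun k => hM ⟨k, rfl⟩⟩
  have heq : d' = d := by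
    refine eq_of_forall_hasSum_convolution H.summable hd hbd (fun m => ?_) fun m => ?_
    · have := H.hasSum_fourier_nodDensity hd hs m
      rw [H.fourier_nodDensity_int] at this
      simpa using this
    · have := hs' m
      rw [hm'] at this
      simpa using this
  subst heq
  ext t
  exact (hs' t).unique (H.hasSum_fourier_nodDensity hd hs t)

theorem existsUnique_isNodFunction (H : IsSpectralDensity φ h) : ∃! ψ, IsNodFunction φ ψ :=
  ⟨_, H.isNodFunction_fourier, fun _ hψ => H.eq_fourier_nodDensity hψ⟩

theorem memLp_shifts (H : IsSpectralDensity φ h) (k : ℤ) :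
    MemLp (shifts (𝓕 (fun x => (nodDensity h x : ℂ))) k) 2 (volume : Measure ℝ) := by
  have h0 : MemLp (𝓕 (fun x => (nodDensity h x : ℂ))) 2 (volume : Measure ℝ) := by
    refine (memLp_two_iff_integrable_sq_norm
      H.continuous_fourier_nodDensity.aestronglyMeasurable).2 ?_
    simp only [sq]
    exact H.integrable_fourier_nodDensity.norm.bdd_mul (c := ∫ x, ‖(nodDensity h x : ℂ)‖)
      H.continuous_fourier_nodDensity.norm.aestronglyMeasurable
      (ae_of_all _ fun t => (norm_norm _).trans_le (norm_fourier_le_integral_norm _ t))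
  exact h0.comp_measurePreserving (measurePreserving_sub_right volume (k : ℝ))

/-- On the Fourier side, the square of the norm of a combination of the shifts is the integral of
`‖trigPoly F c‖² * nodDensity²` over the line, which unfolds to an integral over a period. -/
theorem norm_sq_sum_shifts (H : IsSpectralDensity φ h) (F : Finset ℤ) (c : ℤ → ℂ) :
    ‖∑ k ∈ F, c k • (H.memLp_shifts k).toLp (shifts (𝓕 (fun x => (nodDensity h x : ℂ))) k)‖ ^ 2
      = ∫ x, ‖trigPoly F c x‖ ^ 2 * H.circleSymbol x := by
  set ψ := 𝓕 (fun x => (nodDensity h x : ℂ)) with hψ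
  let g : ℝ → ℂ := fun x => trigPoly F c (x : UnitAddCircle) * (nodDensity h x : ℂ)
  have hgsum : g = ∑ k ∈ F, c k • fun x : ℝ =>
      fourier k (x : UnitAddCircle) * (nodDensity h x : ℂ) := by
    ext x
    simp only [g, trigPoly_apply, Finset.sum_apply, Pi.smul_apply, smul_eq_mul, Finset.sum_mul,
      mul_assoc]
  have hgc : Continuous g := ((trigPoly F c).continuous.comp (AddCircle.continuous_mk' 1)).mul
    (Complex.continuous_ofReal.comp H.continuous_nodDensity)
  have hgi : Integrable g := by
    rw [hgsum]
    exact integrable_finsetSum' _ fun k _ =>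
      (integrable_fourier_mul H.integrable_ofReal_nodDensity k).smul (c k)
  have hFg : 𝓕 g = fun t => ∑ k ∈ F, c k * ψ (t - k) := by
    ext t
    simp only [hψ, ← fourier_mul_fourier_eq_shift]
    simp only [Real.fourier_real_eq_integral_exp_smul, ← integral_const_mul]
    rw [← integral_finsetSum]
    · congr with x
      simp only [g, trigPoly_apply, smul_eq_mul, Finset.sum_mul, Finset.mul_sum]
      exact Finset.sum_congr rfl fun k _ => by ring
    · intro k _
      refine Integrable.const_mul ?_ _
      exact (integrable_fourier_mul H.integrable_ofReal_nodDensity k).bdd_mul (c := 1)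
        (Continuous.aestronglyMeasurable (by fun_prop))
        (ae_of_all _ fun x => (Complex.norm_exp_ofReal_mul_I _).le)
  have hFgi : Integrable (𝓕 g) := by
    rw [hFg]
    exact integrable_finsetSum _ fun k _ =>
      (H.integrable_fourier_nodDensity.comp_sub_right (k : ℝ)).const_mul _
  have hae : (∑ k ∈ F, c k • (H.memLp_shifts k).toLp (shifts ψ k) :
      Lp ℂ 2 (volume : Measure ℝ)) =ᵐ[volume] 𝓕 g := by
    have h1 : ∀ k : ℤ, (c k • (H.memLp_shifts k).toLp (shifts ψ k) :
        Lp ℂ 2 (volume : Measure ℝ)) =ᵐ[volume] fun t => c k * ψ (t - k) := by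
      intro k
      filter_upwards [Lp.coeFn_smul (c k) ((H.memLp_shifts k).toLp (shifts ψ k)),
        (H.memLp_shifts k).coeFn_toLp] with t h1 h2
      rw [h1, Pi.smul_apply, h2, smul_eq_mul, shifts]
    filter_upwards [Lp.coeFn_finsetSum F fun k => c k • (H.memLp_shifts k).toLp (shifts ψ k),
      ae_all_iff.2 h1] with t h2 h3
    rw [h2, Finset.sum_apply, hFg]
    exact Finset.sum_congr rfl fun k _ => h3 k
  -- `g` is bounded, being the inverse transform of an integrable function
  have hsq : Integrable fun x => ((‖g x‖ ^ 2 : ℝ) : ℂ) := by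
    refine Integrable.ofReal (𝕜 := ℂ) (f := fun x => ‖g x‖ ^ 2) ?_
    have h1 : (fun x => ‖g x‖ ^ 2) = fun x => ‖g x‖ * ‖g x‖ := by ext; ring
    rw [h1]
    refine hgi.norm.bdd_mul (c := ∫ x, ‖𝓕 g x‖) hgc.norm.aestronglyMeasurable
      (ae_of_all _ fun x => ?_)
    rw [norm_norm, ← congrFun (hgc.fourierInv_fourier_eq hgi hFgi) x,
      Real.fourierInv_eq_fourier_neg]
    exact norm_fourier_le_integral_norm _ _
  refine (norm_sq_Lp_two _).trans ((integral_congr_ae (hae.fun_comp fun z => ‖z‖ ^ 2)).trans ?_)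
  simp only [Function.comp_def]
  rw [integral_norm_sq_fourier_of_integrable hgc hgi hFgi,
    ← UnitAddCircle.intervalIntegral_preimage 0, zero_add]
  apply Complex.ofReal_injective
  rw [← integral_complex_ofReal, integral_eq_intervalIntegral_tsum hsq,
    ← intervalIntegral.integral_ofReal]
  congr with x
  have h3 : ∀ n : ℤ, ((x + n : ℝ) : UnitAddCircle) = x := fun n => by simp
  have h4 : ∀ n : ℤ, ‖g (x + n)‖ ^ 2
      = ‖trigPoly F c (x : UnitAddCircle)‖ ^ 2 * nodDensity h (x + n) ^ 2 := by
    intro n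
    simp only [g, h3, norm_mul, mul_pow, Complex.norm_real, Real.norm_eq_abs, sq_abs]
  simp only [h4]
  rw [← Complex.ofReal_tsum, tsum_mul_left, (H.hasSum_nodDensity_sq x).tsum_eq, H.circleSymbol_coe]

theorem hasRieszBounds_iff (H : IsSpectralDensity φ h) (hψ : IsNodFunction φ ψ) (A B : ℝ) :
    HasRieszBounds (shifts ψ) A B ↔ ∀ x, A ≤ H.circleSymbol x ∧ H.circleSymbol x ≤ B := by
  obtain rfl := H.eq_fourier_nodDensity hψ
  exact _root_.hasRieszBounds_iff H.memLp_shifts H.circleSymbol H.norm_sq_sum_shifts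

theorem circleSymbol_pos (H : IsSpectralDensity φ h) (x : UnitAddCircle) :
    0 < H.circleSymbol x := by
  induction x using QuotientAddGroup.induction_on with
  | H x => exact H.nodSymbol_pos x

theorem isRieszSystem (H : IsSpectralDensity φ h) (hψ : IsNodFunction φ ψ) :
    IsRieszSystem (shifts ψ) :=
  isRieszSystem_of_iff (H.hasRieszBounds_iff hψ) H.circleSymbol_pos

theorem lowerRieszConstant_eq (H : IsSpectralDensity φ h) (hψ : IsNodFunction φ ψ) {a : ℝ}
    (ha : ∀ x, nodSymbol h a ≤ nodSymbol h x) :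
    lowerRieszConstant (shifts ψ) = nodSymbol h a := by
  refine _root_.lowerRieszConstant_eq (H.hasRieszBounds_iff hψ) H.circleSymbol_pos
    (a := (a : UnitAddCircle)) fun x => ?_
  induction x using QuotientAddGroup.induction_on with
  | H x => exact ha x

theorem upperRieszConstant_eq (H : IsSpectralDensity φ h) (hψ : IsNodFunction φ ψ) {b : ℝ}
    (hb : ∀ x, nodSymbol h x ≤ nodSymbol h b) :
    upperRieszConstant (shifts ψ) = nodSymbol h b := by
  refine _root_.upperRieszConstant_eq (H.hasRieszBounds_iff hψ) H.circleSymbol_pos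
    (b := (b : UnitAddCircle)) fun x => ?_
  induction x using QuotientAddGroup.induction_on with
  | H x => exact hb x

/-- The upper constant dominates all values of the symbol and is one of them. -/
theorem exists_upperRieszConstant_eq (H : IsSpectralDensity φ h) (hψ : IsNodFunction φ ψ) :
    ∃ b : ℝ, upperRieszConstant (shifts ψ) = nodSymbol h b ∧
      ∀ x, nodSymbol h x ≤ nodSymbol h b := by
  obtain ⟨b, h1, h2⟩ :=
    _root_.exists_upperRieszConstant_eq (H.hasRieszBounds_iff hψ) H.circleSymbol_pos
  induction b using QuotientAddGroup.induction_on with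
  | H b => exact ⟨b, h1, fun x => h2 (x : UnitAddCircle)⟩

/-- The nod densities sum to `1` over the translates, hence their squares sum to at most `1`. -/
theorem nodSymbol_le_one (H : IsSpectralDensity φ h) (x : ℝ) : nodSymbol h x ≤ 1 := by
  have hp : ∀ n : ℤ, 0 ≤ nodDensity h (x + n) := fun n =>
    (div_pos (H.pos _) (H.periodize_pos _)).le
  refine hasSum_le (fun n => ?_) (H.hasSum_nodDensity_sq x) (H.hasSum_nodDensity x)
  have h1 : nodDensity h (x + n) ≤ 1 :=
    le_hasSum (H.hasSum_nodDensity x) n fun j _ => hp j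
  exact pow_le_of_le_one (hp n) h1 two_ne_zero

theorem integrable_of_isNodFunction (H : IsSpectralDensity φ h) (hψ : IsNodFunction φ ψ) :
    Integrable ψ := by
  rw [H.eq_fourier_nodDensity hψ]
  exact H.integrable_fourier_nodDensity

/-- By Fourier inversion the transform of the nod function is the nod density, so that its
periodized square is the symbol, up to normalization. -/
theorem hasSum_norm_sq_unitaryFourier (H : IsSpectralDensity φ h) (hψ : IsNodFunction φ ψ)
    (ω : ℝ) :
    HasSum (fun k : ℤ => ‖unitaryFourier ψ (ω + 2 * Real.pi * k)‖ ^ 2)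
      (1 / (2 * Real.pi) * nodSymbol h (ω / (2 * Real.pi))) := by
  have hpi := Real.pi_pos
  have hinv := (Complex.continuous_ofReal.comp H.continuous_nodDensity).fourierInv_fourier_eq
    H.integrable_ofReal_nodDensity H.integrable_fourier_nodDensity
  have heven : ∀ x, nodDensity h (-x) = nodDensity h x := fun x => by
    rw [nodDensity, H.even, periodize_neg H.even, nodDensity]
  have hF : ∀ x, 𝓕 ψ x = nodDensity h x := by
    intro x
    rw [H.eq_fourier_nodDensity hψ, ← heven, ← neg_neg x, ← Real.fourierInv_eq_fourier_neg, neg_neg]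
    exact congrFun hinv (-x)
  convert! (H.hasSum_nodDensity_sq (ω / (2 * Real.pi))).mul_left (1 / (2 * Real.pi)) using 2 with k
  rw [unitaryFourier_eq_fourier, hF, norm_mul, Complex.norm_real, Complex.norm_real, mul_pow,
    Real.norm_eq_abs, Real.norm_eq_abs, sq_abs, sq_abs, div_pow, Real.sq_sqrt (by positivity),
    one_pow]
  congr 3
  field_simp

theorem periodization_eq (H : IsSpectralDensity φ h) (hψ : IsNodFunction φ ψ) (ω : ℝ) :
    periodization ψ ω = nodSymbol h (ω / (2 * Real.pi)) := by
  rw [periodization, (H.hasSum_norm_sq_unitaryFourier hψ ω).tsum_eq]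
  have := Real.pi_pos
  field_simp

end IsSpectralDensity

/-! ### Sums of translates of a Gaussian -/

theorem hasExpDecay_gaussian {s : ℝ} (hs : 0 < s) :
    HasExpDecay fun x => Real.exp (-(s * x ^ 2)) := by
  refine ⟨Real.exp s, 2 * s, by positivity, fun x => ?_⟩
  rw [abs_of_pos (Real.exp_pos _), ← Real.exp_add, Real.exp_le_exp]
  nlinarith [mul_nonneg hs.le (sq_nonneg (|x| - 1)), sq_abs x]

theorem hasExpDecay_deriv_gaussian {s : ℝ} (hs : 0 < s) :
    HasExpDecay fun x => Real.exp (-(s * x ^ 2)) * -(2 * s * x) := by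
  refine ⟨2 * s * Real.exp (1 / s), 1, one_pos, fun x => ?_⟩
  rw [abs_mul, abs_of_pos (Real.exp_pos _), abs_neg, abs_mul,
    abs_of_pos (by positivity : 0 < 2 * s)]
  have h1 : |x| ≤ Real.exp |x| := by linarith [Real.add_one_le_exp |x|]
  -- half of the decay rate `2` is spent on the factor `|x| ≤ exp |x|`
  have h2 : Real.exp (-(s * x ^ 2)) ≤ Real.exp (1 / s) * Real.exp (-(2 * |x|)) := by
    rw [← Real.exp_add, Real.exp_le_exp]
    have h3 : 0 ≤ s * (|x| - 1 / s) ^ 2 := by positivity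
    have h4 : s * (|x| - 1 / s) ^ 2 = s * x ^ 2 - 2 * |x| + 1 / s := by
      rw [← sq_abs x]
      field_simp
      ring
    linarith
  calc Real.exp (-(s * x ^ 2)) * (2 * s * |x|)
      ≤ (Real.exp (1 / s) * Real.exp (-(2 * |x|))) * (2 * s * Real.exp |x|) := by gcongr
    _ = 2 * s * Real.exp (1 / s) * (Real.exp (-(2 * |x|)) * Real.exp |x|) := by ring
    _ = 2 * s * Real.exp (1 / s) * Real.exp (-(1 * |x|)) := by
      rw [← Real.exp_add]; ring_nf

/-- The sum `∑ exp (-s (x + n)²)`, `n ∈ ℤ`. -/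
noncomputable def thetaSum (s x : ℝ) : ℝ := periodize (fun y => Real.exp (-(s * y ^ 2))) x

theorem thetaSum_add_one (s x : ℝ) : thetaSum s (x + 1) = thetaSum s x := periodize_add_one _ x

theorem thetaSum_pos {s : ℝ} (hs : 0 < s) (x : ℝ) : 0 < thetaSum s x :=
  (hasExpDecay_gaussian hs).periodize_pos (fun _ => Real.exp_pos _) x

theorem hasSum_thetaSum {s : ℝ} (hs : 0 < s) (x : ℝ) :
    HasSum (fun n : ℤ => Real.exp (-(s * (x + n) ^ 2))) (thetaSum s x) :=
  ((hasExpDecay_gaussian hs).summable x).hasSum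

theorem hasDerivAt_thetaSum {s : ℝ} (hs : 0 < s) (x : ℝ) :
    HasDerivAt (thetaSum s) (periodize (fun y => Real.exp (-(s * y ^ 2)) * -(2 * s * y)) x) x := by
  refine (hasExpDecay_gaussian hs).hasDerivAt_periodize (hasExpDecay_deriv_gaussian hs)
    (fun y => ?_) x
  have h1 : HasDerivAt (fun y : ℝ => -(s * y ^ 2)) (-(2 * s * y)) y := by
    convert! ((hasDerivAt_pow 2 y).const_mul s).neg using 1
    push_cast
    ring
  exact h1.exp

/-- The decomposition of the lattice `ℤ²` into the pairs `(j, k)` with `j + k` even, written as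
`(u + v, u - v)`, and those with `j + k` odd, written as `(u + v + 1, u - v)`. -/
noncomputable def evenOddEquiv : (ℤ × ℤ) ⊕ (ℤ × ℤ) ≃ ℤ × ℤ :=
  Equiv.ofBijective
    (Sum.elim (fun p => (p.1 + p.2, p.1 - p.2)) fun p => (p.1 + p.2 + 1, p.1 - p.2)) <| by
    constructor
    · rintro (⟨u, v⟩ | ⟨u, v⟩) (⟨u', v'⟩ | ⟨u', v'⟩) h <;>
        simp only [Sum.elim_inl, Sum.elim_inr, Prod.mk.injEq] at h <;>
        simp only [Sum.inl.injEq, Sum.inr.injEq, Prod.mk.injEq, reduceCtorEq] <;> omega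
    · rintro ⟨j, k⟩
      rcases Int.even_or_odd' (j + k) with ⟨m, hm | hm⟩
      · exact ⟨Sum.inl (m, j - m), by ext <;> simp only [Sum.elim_inl] <;> omega⟩
      · exact ⟨Sum.inr (m, j - m - 1), by ext <;> simp only [Sum.elim_inr] <;> omega⟩

/-- Rotating the lattice by 45 degrees turns the product of two Gaussian sums into
Gaussian sums with twice the exponent. -/
theorem thetaSum_mul {s : ℝ} (hs : 0 < s) (x y : ℝ) :
    thetaSum s x * thetaSum s y =
      thetaSum (2 * s) ((x + y) / 2) * thetaSum (2 * s) ((x - y) / 2) +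
        thetaSum (2 * s) ((x + y) / 2 + 1 / 2) * thetaSum (2 * s) ((x - y) / 2 + 1 / 2) := by
  have hprod : ∀ {s : ℝ} (_ : 0 < s) (x y : ℝ), HasSum (fun p : ℤ × ℤ =>
      Real.exp (-(s * (x + p.1) ^ 2)) * Real.exp (-(s * (y + p.2) ^ 2)))
      (thetaSum s x * thetaSum s y) := fun hs x y =>
    (hasSum_thetaSum hs x).mul (hasSum_thetaSum hs y)
      ((hasSum_thetaSum hs x).summable.mul_of_nonneg (hasSum_thetaSum hs y).summable
        (fun _ => (Real.exp_pos _).le) fun _ => (Real.exp_pos _).le)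
  have h2s : 0 < 2 * s := by positivity
  refine (evenOddEquiv.hasSum_iff.2 (hprod hs x y)).unique (HasSum.sum ?_ ?_)
  · convert! hprod h2s ((x + y) / 2) ((x - y) / 2) using 2 with p
    have he : evenOddEquiv (Sum.inl p) = (p.1 + p.2, p.1 - p.2) := rfl
    rw [Function.comp_apply, Function.comp_apply, he]
    rw [← Real.exp_add, ← Real.exp_add]
    congr 1
    push_cast
    ring
  · convert! hprod h2s ((x + y) / 2 + 1 / 2) ((x - y) / 2 + 1 / 2) using 2 with p
    have he : evenOddEquiv (Sum.inr p) = (p.1 + p.2 + 1, p.1 - p.2) := rfl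
    rw [Function.comp_apply, Function.comp_apply, he]
    rw [← Real.exp_add, ← Real.exp_add]
    congr 1
    push_cast
    ring

/-- The quotient `thetaSum s (x + 1 / 2) / thetaSum s x` is largest at `x = 1 / 2`: the difference
of the two sides of the cross-multiplied inequality is a square. -/
theorem thetaSum_add_half_mul_le {s : ℝ} (hs : 0 < s) (x : ℝ) :
    thetaSum s (x + 1 / 2) * thetaSum s (1 / 2) ≤ thetaSum s 0 * thetaSum s x := by
  rw [mul_comm (thetaSum s 0), thetaSum_mul hs x 0, thetaSum_mul hs (x + 1 / 2) (1 / 2)]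
  have h1 : (x + 1 / 2 + 1 / 2) / 2 + 1 / 2 = x / 2 + 1 := by ring
  have h2 : (x + 1 / 2 + 1 / 2) / 2 = x / 2 + 1 / 2 := by ring
  have h3 : (x + 1 / 2 - 1 / 2) / 2 = x / 2 := by ring
  rw [h1, h2, h3, thetaSum_add_one, add_zero, sub_zero]
  nlinarith [sq_nonneg (thetaSum (2 * s) (x / 2) - thetaSum (2 * s) (x / 2 + 1 / 2))]

theorem thetaSum_sq {s : ℝ} (hs : 0 < s) (x : ℝ) :
    thetaSum s x ^ 2 = thetaSum (2 * s) x * thetaSum (2 * s) 0 +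
      thetaSum (2 * s) (x + 1 / 2) * thetaSum (2 * s) (1 / 2) := by
  rw [sq, thetaSum_mul hs]
  have h1 : (x + x) / 2 = x := by ring
  have h2 : (x - x) / 2 = 0 := by ring
  rw [h1, h2, zero_add]

theorem thetaSum_half_sq {s : ℝ} (hs : 0 < s) :
    thetaSum s (1 / 2) ^ 2 = 2 * thetaSum (2 * s) 0 * thetaSum (2 * s) (1 / 2) := by
  have h1 : thetaSum (2 * s) (1 / 2 + 1 / 2) = thetaSum (2 * s) 0 := by
    rw [← thetaSum_add_one _ 0]
    norm_num
  rw [thetaSum_sq hs, h1]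
  ring

theorem thetaSum_half_ratio {s : ℝ} (hs : 0 < s) :
    thetaSum (2 * s) (1 / 2) / thetaSum s (1 / 2) ^ 2 = 1 / (2 * thetaSum (2 * s) 0) := by
  have h2 := thetaSum_pos (by positivity : 0 < 2 * s)
  rw [thetaSum_half_sq hs]
  have := (h2 0).ne'
  have := (h2 (1 / 2)).ne'
  field_simp

/-- The quotient of the Gaussian sums is smallest at `1 / 2`. By `thetaSum_sq`, its reciprocal is
`thetaSum (2 * s) 0` plus a multiple of the quotient maximized in `thetaSum_add_half_mul_le`. -/
theorem thetaSum_half_ratio_le {s : ℝ} (hs : 0 < s) (x : ℝ) :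
    thetaSum (2 * s) (1 / 2) / thetaSum s (1 / 2) ^ 2 ≤ thetaSum (2 * s) x / thetaSum s x ^ 2 := by
  have h2s : 0 < 2 * s := by positivity
  have h2 := thetaSum_pos h2s
  rw [thetaSum_half_ratio hs, div_le_div_iff₀ (by linarith [h2 0]) (pow_pos (thetaSum_pos hs x) 2),
    thetaSum_sq hs x]
  nlinarith [thetaSum_add_half_mul_le h2s x]

/-- Only the term at `n = 0` survives as the Gaussians concentrate. -/
theorem tendsto_thetaSum_zero : Tendsto (fun s => thetaSum s 0) atTop (𝓝 1) := by
  have h1 : Tendsto (fun s : ℝ => ∑' n : ℤ, Real.exp (-(s * ((0 : ℝ) + n) ^ 2))) atTop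
      (𝓝 (∑' n : ℤ, if n = 0 then 1 else 0)) := by
    refine tendsto_tsum_of_dominated_convergence
      (hasSum_thetaSum one_pos 0).summable (fun n => ?_) ?_
    · split_ifs with hn
      · simp [hn]
      · have hn' : (0 : ℝ) < ((0 : ℝ) + n) ^ 2 := by
          rw [zero_add]
          positivity
        exact Real.tendsto_exp_atBot.comp
          (tendsto_neg_atTop_atBot.comp (tendsto_id.atTop_mul_const hn'))
    · filter_upwards [eventually_ge_atTop 1] with s hs n
      rw [Real.norm_of_nonneg (Real.exp_pos _).le]
      gcongr
  rwa [tsum_ite_eq] at h1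

/-! ### The Gauss function -/

/-- The spectral density of the Gauss function. -/
noncomputable def gaussDensity (σ x : ℝ) : ℝ :=
  Real.sqrt (2 * Real.pi * σ ^ 2) * Real.exp (-(2 * Real.pi ^ 2 * σ ^ 2 * x ^ 2))

theorem periodize_gaussDensity (σ x : ℝ) : periodize (gaussDensity σ) x =
    Real.sqrt (2 * Real.pi * σ ^ 2) * thetaSum (2 * Real.pi ^ 2 * σ ^ 2) x :=
  periodize_const_mul _ _ _

theorem fourier_gaussDensity {σ : ℝ} (hσ : 0 < σ) :
    𝓕 (fun x => (gaussDensity σ x : ℂ)) = gaussFun σ := by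
  have hpi := Real.pi_pos
  have hb : 0 < ((2 * Real.pi * σ ^ 2 : ℝ) : ℂ).re := by
    rw [Complex.ofReal_re]; positivity
  have h1 := fourier_gaussian_pi hb
  have h0 : (0 : ℝ) < 2 * Real.pi * σ ^ 2 := by positivity
  have hsq : ((2 * Real.pi * σ ^ 2 : ℝ) : ℂ) ^ (1 / 2 : ℂ) =
      (Real.sqrt (2 * Real.pi * σ ^ 2) : ℝ) := by
    rw [Real.sqrt_eq_rpow, Complex.ofReal_cpow h0.le]
    norm_num
  have h2 : (fun x => (gaussDensity σ x : ℂ)) = fun x : ℝ => (Real.sqrt (2 * Real.pi * σ ^ 2) : ℂ) *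
      Complex.exp (-Real.pi * (2 * Real.pi * σ ^ 2 : ℝ) * x ^ 2) := by
    ext x
    simp only [gaussDensity, Complex.ofReal_mul, Complex.ofReal_exp]
    congr 2
    push_cast
    ring
  ext t
  rw [h2, fourier_const_mul, h1, hsq, ← mul_assoc, gaussFun]
  have h3 : (Real.sqrt (2 * Real.pi * σ ^ 2) : ℂ) ≠ 0 := by
    rw [Complex.ofReal_ne_zero]
    positivity
  rw [mul_one_div_cancel h3, one_mul, Complex.ofReal_exp]
  congr 1
  have h4 : (Real.pi : ℂ) ≠ 0 := by exact_mod_cast hpi.ne'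
  have h5 : (σ : ℂ) ≠ 0 := by exact_mod_cast hσ.ne'
  push_cast
  field_simp

theorem hasExpDecay_gaussFun {σ : ℝ} (hσ : 0 < σ) :
    HasExpDecay fun t => Real.exp (-(t ^ 2 / (2 * σ ^ 2))) := by
  have := hasExpDecay_gaussian (s := 1 / (2 * σ ^ 2)) (by positivity)
  convert this using 4
  ring

theorem isSpectralDensity_gauss {σ : ℝ} (hσ : 0 < σ) :
    IsSpectralDensity (gaussFun σ) (gaussDensity σ) where
  continuous := by unfold gaussDensity; fun_prop
  pos x := by have := Real.pi_pos; unfold gaussDensity; positivity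
  even x := by simp [gaussDensity]
  decay := (hasExpDecay_gaussian (by have := Real.pi_pos; positivity)).const_mul _
  fourier_eq := fourier_gaussDensity hσ
  integrable := ((hasExpDecay_gaussFun hσ).integrable (by fun_prop)).ofReal
  summable := by
    have := ((hasExpDecay_gaussFun hσ).summable 0).map Complex.ofRealHom Complex.continuous_ofReal
    simpa [Function.comp_def, gaussFun] using this
  inv_series := by
    have hpi := Real.pi_pos
    have hs : 0 < 2 * Real.pi ^ 2 * σ ^ 2 := by positivity
    have hne : ∀ x, Real.sqrt (2 * Real.pi * σ ^ 2) * thetaSum (2 * Real.pi ^ 2 * σ ^ 2) x ≠ 0 :=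
      fun x => (mul_pos (by positivity) (thetaSum_pos hs x)).ne'
    have hc : Continuous (thetaSum (2 * Real.pi ^ 2 * σ ^ 2)) :=
      (hasExpDecay_gaussian hs).continuous_periodize (by fun_prop)
    have hc' := (hasExpDecay_deriv_gaussian hs).continuous_periodize (by fun_prop)
    refine exists_inv_series
      (fun x => ((hasDerivAt_thetaSum hs x).const_mul
        (Real.sqrt (2 * Real.pi * σ ^ 2))).inv (hne x))
      ?_ ?_ fun x _ => ?_
    · exact (hc'.const_mul _).neg.div ((hc.const_mul _).pow 2) fun x => pow_ne_zero 2 (hne x)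
    · simp only [Pi.inv_apply]
      rw [← thetaSum_add_one _ 0, zero_add]
    · rw [periodize_gaussDensity]
      rfl

theorem nodSymbol_gaussDensity {σ : ℝ} (hσ : 0 < σ) (x : ℝ) : nodSymbol (gaussDensity σ) x =
    thetaSum (2 * (2 * Real.pi ^ 2 * σ ^ 2)) x / thetaSum (2 * Real.pi ^ 2 * σ ^ 2) x ^ 2 := by
  have hpi := Real.pi_pos
  have h1 : (fun y => gaussDensity σ y ^ 2) = fun y => Real.sqrt (2 * Real.pi * σ ^ 2) ^ 2 *
      Real.exp (-(2 * (2 * Real.pi ^ 2 * σ ^ 2) * y ^ 2)) := by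
    ext y
    rw [gaussDensity, mul_pow, ← Real.exp_nat_mul]
    congr 2
    push_cast
    ring
  rw [nodSymbol, periodize_gaussDensity, h1, periodize_const_mul, mul_pow, ← thetaSum]
  exact mul_div_mul_left _ _ (by positivity)

theorem nodSymbol_gaussDensity_half_le {σ : ℝ} (hσ : 0 < σ) (x : ℝ) :
    nodSymbol (gaussDensity σ) (1 / 2) ≤ nodSymbol (gaussDensity σ) x := by
  have hpi := Real.pi_pos
  rw [nodSymbol_gaussDensity hσ, nodSymbol_gaussDensity hσ]
  exact thetaSum_half_ratio_le (by positivity) x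

theorem tendsto_two_mul_pi_sq_mul_sq :
    Tendsto (fun σ : ℝ => 2 * Real.pi ^ 2 * σ ^ 2) atTop atTop :=
  (tendsto_pow_atTop two_ne_zero).const_mul_atTop (by have := Real.pi_pos; positivity)

theorem tendsto_nodSymbol_gaussDensity_half :
    Tendsto (fun σ => nodSymbol (gaussDensity σ) (1 / 2)) atTop (𝓝 (1 / 2)) := by
  have h1 : Tendsto (fun σ : ℝ => 1 / (2 * thetaSum (2 * (2 * Real.pi ^ 2 * σ ^ 2)) 0)) atTop
      (𝓝 (1 / (2 * 1))) :=
    tendsto_const_nhds.div ((tendsto_thetaSum_zero.comp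
      (tendsto_two_mul_pi_sq_mul_sq.const_mul_atTop two_pos)).const_mul 2) (by norm_num)
  rw [mul_one] at h1
  refine h1.congr' ?_
  filter_upwards [eventually_gt_atTop 0] with σ hσ
  have hpi := Real.pi_pos
  rw [nodSymbol_gaussDensity hσ, thetaSum_half_ratio (by positivity)]

theorem tendsto_nodSymbol_gaussDensity_zero :
    Tendsto (fun σ => nodSymbol (gaussDensity σ) 0) atTop (𝓝 1) := by
  have h1 : Tendsto (fun σ : ℝ => thetaSum (2 * (2 * Real.pi ^ 2 * σ ^ 2)) 0 /
      thetaSum (2 * Real.pi ^ 2 * σ ^ 2) 0 ^ 2) atTop (𝓝 (1 / 1 ^ 2)) :=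
    (tendsto_thetaSum_zero.comp (tendsto_two_mul_pi_sq_mul_sq.const_mul_atTop two_pos)).div
      ((tendsto_thetaSum_zero.comp tendsto_two_mul_pi_sq_mul_sq).pow 2) (by norm_num)
  rw [one_pow, div_one] at h1
  refine h1.congr' ?_
  filter_upwards [eventually_gt_atTop 0] with σ hσ
  rw [nodSymbol_gaussDensity hσ]

/-! ### The Lorentz function -/

theorem fourier_exp_neg_mul_abs {a : ℝ} (ha : 0 < a) (t : ℝ) :
    𝓕 (fun x : ℝ => (Real.exp (-(a * |x|)) : ℂ)) t =
      ((2 * a / (a ^ 2 + (2 * Real.pi * t) ^ 2) : ℝ) : ℂ) := by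
  let w : ℂ := a - 2 * Real.pi * t * Complex.I
  let z : ℂ := -a - 2 * Real.pi * t * Complex.I
  have hw : w.re = a := by simp [w]
  have hz : z.re = -a := by simp [z]
  have hw0 : w ≠ 0 := fun h => ha.ne' (by rw [← hw, h, Complex.zero_re])
  have hz0 : z ≠ 0 := fun h => ha.ne' (by rw [← neg_neg a, ← hz, h, Complex.zero_re, neg_zero])
  have h1 : ∀ x ∈ Set.Iic (0 : ℝ), Complex.exp ((-2 * Real.pi * x * t : ℝ) * Complex.I) •
      (Real.exp (-(a * |x|)) : ℂ) = Complex.exp (w * x) := by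
    intro x hx
    rw [abs_of_nonpos hx, smul_eq_mul, Complex.ofReal_exp, ← Complex.exp_add]
    congr 1
    simp only [w]
    push_cast
    ring
  have h2 : ∀ x ∈ Set.Ioi (0 : ℝ), Complex.exp ((-2 * Real.pi * x * t : ℝ) * Complex.I) •
      (Real.exp (-(a * |x|)) : ℂ) = Complex.exp (z * x) := by
    intro x hx
    rw [abs_of_pos hx, smul_eq_mul, Complex.ofReal_exp, ← Complex.exp_add]
    congr 1
    simp only [z]
    push_cast
    ring
  have hwr : 0 < w.re := hw ▸ ha
  have hzr : z.re < 0 := by rw [hz]; linarith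
  rw [Real.fourier_real_eq_integral_exp_smul, ← intervalIntegral.integral_Iic_add_Ioi (b := 0)
    ((integrableOn_exp_mul_complex_Iic hwr 0).congr_fun (fun x hx => (h1 x hx).symm)
      measurableSet_Iic)
    ((integrableOn_exp_mul_complex_Ioi hzr 0).congr_fun (fun x hx => (h2 x hx).symm)
      measurableSet_Ioi),
    setIntegral_congr_fun measurableSet_Iic h1, setIntegral_congr_fun measurableSet_Ioi h2,
    integral_exp_mul_complex_Iic hwr, integral_exp_mul_complex_Ioi hzr]
  have hwz : w * z = -((a ^ 2 + (2 * Real.pi * t) ^ 2 : ℝ) : ℂ) := by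
    simp only [w, z]
    push_cast
    ring_nf
    rw [Complex.I_sq]
    ring
  have hne : ((a ^ 2 + (2 * Real.pi * t) ^ 2 : ℝ) : ℂ) ≠ 0 := by
    rw [Complex.ofReal_ne_zero]; positivity
  simp only [Complex.ofReal_zero, mul_zero, Complex.exp_zero]
  rw [Complex.ofReal_div, div_add_div _ _ hw0 hz0, hwz, div_eq_div_iff (neg_ne_zero.2 hne) hne]
  simp only [w, z]
  push_cast
  ring

theorem hasExpDecay_exp_neg_mul_abs {a : ℝ} (ha : 0 < a) :
    HasExpDecay fun x => Real.exp (-(a * |x|)) :=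
  ⟨1, a, ha, fun x => by rw [abs_of_pos (Real.exp_pos _), one_mul]⟩

/-- The periodization of `exp (-a |x|)` on a period, by summing two geometric series. -/
theorem periodize_exp_neg_mul_abs {a : ℝ} (ha : 0 < a) {x : ℝ} (h0 : 0 ≤ x) (h1 : x ≤ 1) :
    periodize (fun y => Real.exp (-(a * |y|))) x =
      Real.cosh (a * (1 / 2 - x)) / Real.sinh (a / 2) := by
  have hlt : Real.exp (-a) < 1 := Real.exp_lt_one_iff.2 (by linarith)
  have hg := hasSum_geometric_of_lt_one (Real.exp_pos (-a)).le hlt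
  have hpos : HasSum (fun n : ℕ => Real.exp (-(a * |x + ((n : ℤ) : ℝ)|)))
      (Real.exp (-(a * x)) * (1 - Real.exp (-a))⁻¹) := by
    convert! hg.mul_left (Real.exp (-(a * x))) using 2 with n
    rw [abs_of_nonneg (by positivity), ← Real.exp_nat_mul, ← Real.exp_add]
    push_cast
    ring_nf
  have hneg : HasSum (fun n : ℕ => Real.exp (-(a * |x + ((-((n : ℤ) + 1) : ℤ) : ℝ)|)))
      (Real.exp (-(a * (1 - x))) * (1 - Real.exp (-a))⁻¹) := by
    convert! hg.mul_left (Real.exp (-(a * (1 - x)))) using 2 with n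
    have hn : (0 : ℝ) ≤ n := n.cast_nonneg
    rw [abs_of_nonpos (by push_cast; linarith), ← Real.exp_nat_mul, ← Real.exp_add]
    push_cast
    ring_nf
  have hsum := HasSum.of_nat_of_neg_add_one
    (f := fun n : ℤ => Real.exp (-(a * |x + (n : ℝ)|))) hpos hneg
  rw [periodize, hsum.tsum_eq, Real.cosh_eq, Real.sinh_eq]
  have h3 : Real.exp (-(a * x)) = Real.exp (a * (1 / 2 - x)) * Real.exp (-(a / 2)) := by
    rw [← Real.exp_add]; ring_nf
  have h4 : Real.exp (-(a * (1 - x))) = Real.exp (-(a * (1 / 2 - x))) * Real.exp (-(a / 2)) := by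
    rw [← Real.exp_add]; ring_nf
  have h5 : Real.exp (-a) = Real.exp (-(a / 2)) * Real.exp (-(a / 2)) := by
    rw [← Real.exp_add]; ring_nf
  have h6 : Real.exp (a / 2) = (Real.exp (-(a / 2)))⁻¹ := by rw [← Real.exp_neg, neg_neg]
  have h7 : Real.exp (-(a / 2)) ≠ 0 := (Real.exp_pos _).ne'
  have h8 : 1 - Real.exp (-(a / 2)) * Real.exp (-(a / 2)) ≠ 0 := by rw [← h5]; linarith
  rw [h3, h4, h5, h6]
  generalize Real.exp (-(a / 2)) = e at h7 h8 ⊢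
  have h9 : e⁻¹ - e ≠ 0 := by
    intro h
    apply h8
    field_simp at h
    linarith
  rw [← div_eq_mul_inv, ← div_eq_mul_inv, ← add_div, div_eq_div_iff h8 (by simpa using h9)]
  field_simp

/-- The spectral density of the Lorentz function. -/
noncomputable def lorentzDensity (σ x : ℝ) : ℝ :=
  Real.pi * σ * Real.exp (-(2 * Real.pi * σ * |x|))

theorem periodize_lorentzDensity {σ : ℝ} (hσ : 0 < σ) {x : ℝ} (h0 : 0 ≤ x) (h1 : x ≤ 1) :
    periodize (lorentzDensity σ) x = Real.pi * σ *
      (Real.cosh (2 * Real.pi * σ * (1 / 2 - x)) / Real.sinh (2 * Real.pi * σ / 2)) := by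
  have hpi := Real.pi_pos
  rw [← periodize_exp_neg_mul_abs (by positivity) h0 h1, ← periodize_const_mul]
  rfl

theorem fourier_lorentzDensity {σ : ℝ} (hσ : 0 < σ) :
    𝓕 (fun x => (lorentzDensity σ x : ℂ)) = lorentzFun σ := by
  have hpi := Real.pi_pos
  ext t
  simp only [lorentzDensity, Complex.ofReal_mul (Real.pi * σ)]
  rw [fourier_const_mul, fourier_exp_neg_mul_abs (by positivity), lorentzFun, ← Complex.ofReal_mul]
  congr 1
  have : σ ^ 2 + t ^ 2 ≠ 0 := by positivity
  field_simp

theorem integrable_lorentzFun {σ : ℝ} (hσ : 0 < σ) : Integrable (lorentzFun σ) := by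
  refine Integrable.ofReal (𝕜 := ℂ) (f := fun t => σ ^ 2 / (σ ^ 2 + t ^ 2)) ?_
  refine (integrable_inv_one_add_sq.comp_div hσ.ne').congr (ae_of_all _ fun t => ?_)
  have : σ ^ 2 + t ^ 2 ≠ 0 := by positivity
  simp only
  field_simp

theorem summable_lorentzFun (σ : ℝ) : Summable fun m : ℤ => lorentzFun σ m := by
  refine Summable.of_norm_bounded_eventually
    ((Real.summable_one_div_int_pow.2 one_lt_two).mul_left (σ ^ 2)) ?_
  filter_upwards [(Set.finite_singleton (0 : ℤ)).eventually_cofinite_notMem] with m hm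
  have hm0 : (m : ℝ) ≠ 0 := Int.cast_ne_zero.2 hm
  rw [lorentzFun, Complex.norm_real, Real.norm_of_nonneg (by positivity), mul_one_div]
  gcongr
  exact le_add_of_nonneg_left (sq_nonneg σ)

theorem isSpectralDensity_lorentz {σ : ℝ} (hσ : 0 < σ) :
    IsSpectralDensity (lorentzFun σ) (lorentzDensity σ) where
  continuous := by unfold lorentzDensity; fun_prop
  pos x := by have := Real.pi_pos; unfold lorentzDensity; positivity
  even x := by simp [lorentzDensity]
  decay := (hasExpDecay_exp_neg_mul_abs (by have := Real.pi_pos; positivity)).const_mul _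
  fourier_eq := fourier_lorentzDensity hσ
  integrable := integrable_lorentzFun hσ
  summable := summable_lorentzFun σ
  inv_series := by
    have hpi := Real.pi_pos
    have hsinh : 0 < Real.sinh (2 * Real.pi * σ / 2) := Real.sinh_pos_iff.2 (by positivity)
    have hd : ∀ x : ℝ, HasDerivAt (fun x => Real.pi * σ *
        (Real.cosh (2 * Real.pi * σ * (1 / 2 - x)) / Real.sinh (2 * Real.pi * σ / 2)))
        (Real.pi * σ * (Real.sinh (2 * Real.pi * σ * (1 / 2 - x)) * (2 * Real.pi * σ * -1) /
          Real.sinh (2 * Real.pi * σ / 2))) x := fun x =>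
      (((((hasDerivAt_id x).const_sub (1 / 2)).const_mul (2 * Real.pi * σ)).cosh).div_const
        _).const_mul _
    have hne : ∀ x : ℝ, Real.pi * σ *
        (Real.cosh (2 * Real.pi * σ * (1 / 2 - x)) / Real.sinh (2 * Real.pi * σ / 2)) ≠ 0 :=
      fun x => by have := Real.cosh_pos (2 * Real.pi * σ * (1 / 2 - x)); positivity
    refine exists_inv_series (fun x => (hd x).inv (hne x)) ?_ ?_ fun x hx => ?_
    · exact Continuous.div (by fun_prop) (by fun_prop) fun x => pow_ne_zero 2 (hne x)
    · -- the two end points of the period correspond under evenness of `cosh`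
      simp only [Pi.inv_apply]
      rw [← Real.cosh_neg]
      ring_nf
    · rw [periodize_lorentzDensity hσ hx.1 hx.2.le]
      rfl

/-- The symbol of the Lorentz nod function on a period. -/
theorem nodSymbol_lorentzDensity {σ : ℝ} (hσ : 0 < σ) {x : ℝ} (h0 : 0 ≤ x) (h1 : x ≤ 1) :
    nodSymbol (lorentzDensity σ) x = Real.sinh (σ * Real.pi) ^ 2 / Real.sinh (2 * σ * Real.pi) *
      (2 - 1 / Real.cosh (2 * Real.pi * σ * (1 / 2 - x)) ^ 2) := by
  have hpi := Real.pi_pos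
  have h2 : (fun y => lorentzDensity σ y ^ 2) = fun y => (Real.pi * σ) ^ 2 *
      Real.exp (-(4 * Real.pi * σ * |y|)) := by
    ext y
    rw [lorentzDensity, mul_pow, ← Real.exp_nat_mul]
    congr 2
    push_cast
    ring
  have e1 : 4 * Real.pi * σ / 2 = 2 * σ * Real.pi := by ring
  have e2 : 2 * Real.pi * σ / 2 = σ * Real.pi := by ring
  have e3 : 4 * Real.pi * σ * (1 / 2 - x) = 2 * (2 * Real.pi * σ * (1 / 2 - x)) := by ring
  rw [nodSymbol, periodize_lorentzDensity hσ h0 h1, h2, periodize_const_mul,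
    periodize_exp_neg_mul_abs (by positivity) h0 h1, e1, e2, e3, Real.cosh_two_mul, Real.sinh_sq]
  have hs1 : Real.sinh (σ * Real.pi) ≠ 0 := (Real.sinh_pos_iff.2 (by positivity)).ne'
  have hs2 : Real.sinh (2 * σ * Real.pi) ≠ 0 := (Real.sinh_pos_iff.2 (by positivity)).ne'
  have hc := (Real.cosh_pos (2 * Real.pi * σ * (1 / 2 - x))).ne'
  field_simp
  ring

theorem nodSymbol_lorentzDensity_half {σ : ℝ} (hσ : 0 < σ) :
    nodSymbol (lorentzDensity σ) (1 / 2) =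
      Real.sinh (σ * Real.pi) ^ 2 / Real.sinh (2 * σ * Real.pi) := by
  rw [nodSymbol_lorentzDensity hσ (by norm_num) (by norm_num)]
  norm_num

theorem nodSymbol_lorentzDensity_zero {σ : ℝ} (hσ : 0 < σ) :
    nodSymbol (lorentzDensity σ) 0 =
      Real.sinh (σ * Real.pi) ^ 2 / Real.sinh (2 * σ * Real.pi) *
        (2 - 1 / Real.cosh (σ * Real.pi) ^ 2) := by
  rw [nodSymbol_lorentzDensity hσ le_rfl zero_le_one]
  ring_nf

theorem nodSymbol_lorentzDensity_bounds {σ : ℝ} (hσ : 0 < σ) (x : ℝ) :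
    nodSymbol (lorentzDensity σ) (1 / 2) ≤ nodSymbol (lorentzDensity σ) x ∧
      nodSymbol (lorentzDensity σ) x ≤ nodSymbol (lorentzDensity σ) 0 := by
  have hpi := Real.pi_pos
  have hfract : nodSymbol (lorentzDensity σ) (Int.fract x) = nodSymbol (lorentzDensity σ) x := by
    rw [nodSymbol, ← periodize_add_int _ _ ⌊x⌋, ← periodize_add_int (lorentzDensity σ) _ ⌊x⌋,
      Int.fract_add_floor]
    rfl
  have hf0 := Int.fract_nonneg x
  have hf1 := (Int.fract_lt_one x).le
  have hs2 : 0 < Real.sinh (2 * σ * Real.pi) := Real.sinh_pos_iff.2 (by positivity)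
  have hk : 0 ≤ Real.sinh (σ * Real.pi) ^ 2 / Real.sinh (2 * σ * Real.pi) := by positivity
  rw [← hfract, nodSymbol_lorentzDensity_half hσ, nodSymbol_lorentzDensity_zero hσ,
    nodSymbol_lorentzDensity hσ hf0 hf1]
  set c := Real.cosh (2 * Real.pi * σ * (1 / 2 - Int.fract x)) with hc
  have hc1 : 1 ≤ c := Real.one_le_cosh _
  have hc2 : c ≤ Real.cosh (σ * Real.pi) := by
    rw [hc, Real.cosh_le_cosh, abs_of_pos (by positivity : 0 < σ * Real.pi), abs_le]
    have : 0 < Real.pi * σ := by positivity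
    constructor <;> nlinarith
  constructor
  · refine le_mul_of_one_le_right hk ?_
    have : 1 / c ^ 2 ≤ 1 := (div_le_one (by positivity)).2 (one_le_pow₀ hc1)
    linarith
  · gcongr

theorem sinh_sq_div_sinh_two_mul {σ : ℝ} (hσ : 0 < σ) :
    Real.sinh (σ * Real.pi) ^ 2 / Real.sinh (2 * σ * Real.pi) = Real.tanh (σ * Real.pi) / 2 := by
  have hpi := Real.pi_pos
  have hs1 : Real.sinh (σ * Real.pi) ≠ 0 := (Real.sinh_pos_iff.2 (by positivity)).ne'
  rw [mul_assoc, Real.sinh_two_mul, Real.tanh_eq_sinh_div_cosh]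
  field_simp

theorem tendsto_tanh_mul_pi : Tendsto (fun σ => Real.tanh (σ * Real.pi)) atTop (𝓝 1) := by
  have h1 : Tendsto (fun σ => 1 - Real.exp (-(σ * Real.pi))) atTop (𝓝 1) := by
    simpa using (Real.tendsto_exp_atBot.comp (tendsto_neg_atTop_atBot.comp
      (tendsto_id.atTop_mul_const Real.pi_pos))).const_sub 1
  refine tendsto_of_tendsto_of_tendsto_of_le_of_le h1 tendsto_const_nhds (fun σ => ?_)
    fun σ => (Real.tanh_lt_one _).le
  have hc := Real.one_le_cosh (σ * Real.pi)
  have h2 := Real.cosh_sub_sinh (σ * Real.pi)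
  have h3 := Real.exp_pos (-(σ * Real.pi))
  simp only
  rw [Real.tanh_eq_sinh_div_cosh, le_div_iff₀ (by linarith)]
  nlinarith

theorem tendsto_nodSymbol_lorentzDensity_half :
    Tendsto (fun σ => nodSymbol (lorentzDensity σ) (1 / 2)) atTop (𝓝 (1 / 2)) := by
  refine (tendsto_tanh_mul_pi.div_const 2).congr' ?_
  filter_upwards [eventually_gt_atTop 0] with σ hσ
  rw [nodSymbol_lorentzDensity_half hσ, sinh_sq_div_sinh_two_mul hσ]

theorem tendsto_nodSymbol_lorentzDensity_zero :
    Tendsto (fun σ => nodSymbol (lorentzDensity σ) 0) atTop (𝓝 1) := by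
  have h1 := (tendsto_tanh_mul_pi.div_const 2).mul ((tendsto_tanh_mul_pi.pow 2).const_add 1)
  norm_num at h1
  refine h1.congr' ?_
  filter_upwards [eventually_gt_atTop 0] with σ hσ
  rw [nodSymbol_lorentzDensity_zero hσ, sinh_sq_div_sinh_two_mul hσ]
  congr 1
  have hc := (Real.cosh_pos (σ * Real.pi)).ne'
  rw [Real.tanh_eq_sinh_div_cosh]
  field_simp
  rw [Real.sinh_sq]
  ring

theorem theorem3 :
    -- the nod functions exist and are unique
    (∀ σ : ℝ, 0 < σ → ∃! ψ : ℝ → ℂ, IsNodFunction (gaussFun σ) ψ) ∧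
    (∀ σ : ℝ, 0 < σ → ∃! ψ : ℝ → ℂ, IsNodFunction (lorentzFun σ) ψ) ∧
    ∀ ψG ψL : ℝ → ℝ → ℂ,
      (∀ σ : ℝ, 0 < σ → IsNodFunction (gaussFun σ) (ψG σ)) →
      (∀ σ : ℝ, 0 < σ → IsNodFunction (lorentzFun σ) (ψL σ)) →
      -- their integer shifts form Riesz systems
      (∀ σ : ℝ, 0 < σ → IsRieszSystem (shifts (ψG σ))) ∧
      (∀ σ : ℝ, 0 < σ → IsRieszSystem (shifts (ψL σ))) ∧
      -- limits of the Riesz constants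
      Tendsto (fun σ => lowerRieszConstant (shifts (ψG σ))) atTop (𝓝 (1 / 2)) ∧
      Tendsto (fun σ => lowerRieszConstant (shifts (ψL σ))) atTop (𝓝 (1 / 2)) ∧
      Tendsto (fun σ => upperRieszConstant (shifts (ψG σ))) atTop (𝓝 1) ∧
      Tendsto (fun σ => upperRieszConstant (shifts (ψL σ))) atTop (𝓝 1) ∧
      -- the explicit constants in the Lorentz case
      (∀ σ : ℝ, 0 < σ →
        lowerRieszConstant (shifts (ψL σ)) =
          Real.sinh (σ * Real.pi) ^ 2 / Real.sinh (2 * σ * Real.pi) ∧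
        upperRieszConstant (shifts (ψL σ)) =
          Real.sinh (σ * Real.pi) ^ 2 / Real.sinh (2 * σ * Real.pi) *
            (2 - 1 / Real.cosh (σ * Real.pi) ^ 2)) ∧
      -- in the Gauss case the minimum of the periodization is attained at `π`
      (∀ σ : ℝ, 0 < σ →
        Integrable (ψG σ) ∧
        (∀ ω : ℝ, Summable fun k : ℤ =>
          ‖unitaryFourier (ψG σ) (ω + 2 * Real.pi * k)‖ ^ 2) ∧
        (∀ ω : ℝ, periodization (ψG σ) Real.pi ≤ periodization (ψG σ) ω) ∧
        lowerRieszConstant (shifts (ψG σ)) = periodization (ψG σ) Real.pi) := by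
  refine ⟨fun σ hσ => (isSpectralDensity_gauss hσ).existsUnique_isNodFunction,
    fun σ hσ => (isSpectralDensity_lorentz hσ).existsUnique_isNodFunction,
    fun ψG ψL hG hL => ?_⟩
  have hlowG : ∀ σ : ℝ, 0 < σ →
      lowerRieszConstant (shifts (ψG σ)) = nodSymbol (gaussDensity σ) (1 / 2) := fun σ hσ =>
    (isSpectralDensity_gauss hσ).lowerRieszConstant_eq (hG σ hσ)
      (nodSymbol_gaussDensity_half_le hσ)
  have hlowL : ∀ σ : ℝ, 0 < σ →
      lowerRieszConstant (shifts (ψL σ)) = nodSymbol (lorentzDensity σ) (1 / 2) := fun σ hσ =>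
    (isSpectralDensity_lorentz hσ).lowerRieszConstant_eq (hL σ hσ)
      fun x => (nodSymbol_lorentzDensity_bounds hσ x).1
  have hupL : ∀ σ : ℝ, 0 < σ →
      upperRieszConstant (shifts (ψL σ)) = nodSymbol (lorentzDensity σ) 0 := fun σ hσ =>
    (isSpectralDensity_lorentz hσ).upperRieszConstant_eq (hL σ hσ)
      fun x => (nodSymbol_lorentzDensity_bounds hσ x).2
  have hpi : Real.pi / (2 * Real.pi) = 1 / 2 := by
    have := Real.pi_ne_zero
    field_simp
  refine ⟨fun σ hσ => (isSpectralDensity_gauss hσ).isRieszSystem (hG σ hσ),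
    fun σ hσ => (isSpectralDensity_lorentz hσ).isRieszSystem (hL σ hσ), ?_, ?_, ?_, ?_, ?_, ?_⟩
  · refine tendsto_nodSymbol_gaussDensity_half.congr' ?_
    filter_upwards [eventually_gt_atTop 0] with σ hσ using (hlowG σ hσ).symm
  · refine tendsto_nodSymbol_lorentzDensity_half.congr' ?_
    filter_upwards [eventually_gt_atTop 0] with σ hσ using (hlowL σ hσ).symm
  · refine tendsto_of_tendsto_of_tendsto_of_le_of_le' tendsto_nodSymbol_gaussDensity_zero
      tendsto_const_nhds ?_ ?_
    all_goals
      filter_upwards [eventually_gt_atTop 0] with σ hσ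
      obtain ⟨b, hb, hmax⟩ :=
        (isSpectralDensity_gauss hσ).exists_upperRieszConstant_eq (hG σ hσ)
      rw [hb]
    · exact hmax 0
    · exact (isSpectralDensity_gauss hσ).nodSymbol_le_one b
  · refine tendsto_nodSymbol_lorentzDensity_zero.congr' ?_
    filter_upwards [eventually_gt_atTop 0] with σ hσ using (hupL σ hσ).symm
  · intro σ hσ
    rw [hlowL σ hσ, hupL σ hσ, nodSymbol_lorentzDensity_half hσ, nodSymbol_lorentzDensity_zero hσ]
    exact ⟨rfl, rfl⟩
  · intro σ hσ
    have H := isSpectralDensity_gauss hσ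
    refine ⟨H.integrable_of_isNodFunction (hG σ hσ),
      fun ω => (H.hasSum_norm_sq_unitaryFourier (hG σ hσ) ω).summable, fun ω => ?_, ?_⟩
    · rw [H.periodization_eq (hG σ hσ), H.periodization_eq (hG σ hσ), hpi]
      exact nodSymbol_gaussDensity_half_le hσ _
    · rw [H.periodization_eq (hG σ hσ), hpi, hlowG σ hσ]
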